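/- Let $\mathbb{O}$ be the real algebra with basis $1=e_0,e_1,\dots,e_7$, unit $1$, and $e_ie_j=-\delta_{ij}+\sum_k\phi_{ijk}e_k$ $(1\le i,j\le 7)$, where $\phi_{ijk}$ is completely antisymmetric, equals $1$ for $ijk=123,246,435,367,651,572,714$, and vanishes on all triples that are not permutations of these. Let $2^3.PSL_2(7)$ denote the group of all algebra automorphisms of $\mathbb{O}$ that map the set $\{\pm e_1,\dots,\pm e_7\}$ onto itself, and let $2^3:PSL_2(7)$ denote the semidirect product of the elementary abelian group $2^3$ of order $8$ by $PSL_2(7)$, where $PSL_2(7)$ acts on $2^3$ through an isomorphism $PSL_2(7)\cong\mathrm{Aut}(2^3)$. (Such isomorphisms exist, and the assertions hold for each choice of one.) Then $2^3.PSL_2(7)$ is a non-split extension of $2^3$ by $PSL_2(7)$ which induces on $2^3$, by conjugation, its full automorphism group; the groups $2^3.PSL_2(7)$ and $2^3:PSL_2(7)$ are not isomorphic; yet they have the same character table, with the same class sizes, namely the following table, in which $\eta=\tfrac12(-1+i\sqrt7)$. Each group has exactly 11 conjugacy classes $C_1,\dots,C_{11}$ and exactly 11 irreducible complex characters. The first two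 lines give the orders of the elements of the classes in $2^3.PSL_2(7)$ and in $2^3:PSL_2(7)$, and the third line gives the number of elements of each class in either group. $$\begin{array}{l|rrrrrrrrrrr} & C_1&C_2&C_3&C_4&C_5&C_6&C_7&C_8&C_9&C_{10}&C_{11}\\\hline \text{order in }2^3.PSL_2(7)&1&2&2&3&4&4&6&7&7&8&8\\ \text{order in }2^3:PSL_2(7)&1&2&4&3&2&2&6&7&7&4&4\\ \text{number of elements}&1&7&84&224&42&42&224&192&192&168&168\\\hline \chi^{[1]}&1&1&1&1&1&1&1&1&1&1&1\\ \chi^{[3_1]}&3&3&-1&0&-1&-1&0&\eta&\bar\eta&1&1\\ \chi^{[3_2]}&3&3&-1&0&-1&-1&0&\bar\eta&\eta&1&1\\ \chi^{[6]}&6&6&2&0&2&2&0&-1&-1&0&0\\ \chi^{[7_1]}&7&-1&-1&1&-1&3&-1&0&0&1&-1\\ \chi^{[7_2]}&7&7&-1&1&-1&-1&1&0&0&-1&-1\\ \chi^{[7_3]}&7&-1&-1&1&3&-1&-1&0&0&-1&1\\ \chi^{[8]}&8&8&0&-1&0&0&-1&1&1&0&0\\ \chi^{[14]}&14&-2&-2&-1&2&2&1&0&0&0&0\\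 \chi^{[21_1]}&21&-3&1&0&-3&1&0&0&0&-1&1\\ \chi^{[21_2]}&21&-3&1&0&1&-3&0&0&0&1&-1 \end{array}$$ In both groups every irreducible representation of dimension other than $3$ is real (its character is the character of a representation over $\mathbb{R}$), whereas the two irreducible characters of degree $3$ are not real-valued and are complex conjugates of each other. -/

import Mathlib

/-! ### The octonions and the automorphism group of the set of signed imaginary units -/

/-- Octonions with real coefficients `(q₀, q₁, …, q₇)`, i.e. `q₀ · 1 + q₁ e₁ + ⋯ + q₇ e₇`. -/
abbrev Octonion : Type := Fin 8 → ℝ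

/-- The seven oriented associative triads `(i, j, k)`, those with `e_i e_j = e_k`. -/
def octonionTriads : List (Fin 8 × Fin 8 × Fin 8) :=
  [(1, 2, 3), (2, 4, 6), (4, 3, 5), (3, 6, 7), (6, 5, 1), (5, 7, 2), (7, 1, 4)]

/-- `(i, j, k)` is a cyclic rotation of one of the seven triads. -/
def IsCyclicTriad (i j k : Fin 8) : Prop :=
  (i, j, k) ∈ octonionTriads ∨ (j, k, i) ∈ octonionTriads ∨ (k, i, j) ∈ octonionTriads

instance (i j k : Fin 8) : Decidable (IsCyclicTriad i j k) :=
  inferInstanceAs (Decidable (_ ∨ _ ∨ _))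

/-- The completely antisymmetric symbol `φ_{ijk}` with value `1` on the seven triads,
and `0` on the index triples that are not a permutation of a triad. -/
def octonionPhi (i j k : Fin 8) : ℤ :=
  if IsCyclicTriad i j k then 1 else if IsCyclicTriad j i k then -1 else 0

/-- The coefficient of `e_k` in the product `e_i e_j` (with `e_0 = 1`):
`1 e_j = e_j`, `e_i 1 = e_i` and `e_i e_j = - δ_{ij} + ∑ k, φ_{ijk} e_k` for `i, j ≥ 1`. -/
def octonionStructureConst (i j k : Fin 8) : ℤ :=
  if i = 0 then (if j = k then 1 else 0)
  else if j = 0 then (if i = k then 1 else 0)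
  else if k = 0 then (if i = j then -1 else 0)
  else octonionPhi i j k

/-- The (bilinear, nonassociative) octonion product. -/
def octonionMul (x y : Octonion) : Octonion :=
  fun k => ∑ i, ∑ j, (octonionStructureConst i j k : ℝ) * (x i * y j)

/-- The set `{± e_1, …, ± e_7}` of signed imaginary units. -/
def octonionSignedUnits : Set Octonion :=
  {x | ∃ i : Fin 8, i ≠ 0 ∧ (x = Pi.single i 1 ∨ x = -Pi.single i 1)}

/-- The automorphism group of the octonionic set `± e_i`: all automorphisms of the octonion
algebra that map the set `{± e_1, …, ± e_7}` onto itself. This is the group `2^3.PSL_2(7)`. -/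
def octonionUnitAut : Subgroup (Octonion ≃ₗ[ℝ] Octonion) where
  carrier := {f | (∀ x y, f (octonionMul x y) = octonionMul (f x) (f y)) ∧
    f '' octonionSignedUnits = octonionSignedUnits}
  one_mem' := ⟨fun _ _ => rfl, by simp⟩
  mul_mem' := by
    rintro f g ⟨hf, hf'⟩ ⟨hg, hg'⟩
    refine ⟨fun x y => ?_, ?_⟩
    · simp only [LinearEquiv.mul_apply, hf, hg]
    · have h : ⇑(f * g) = ⇑f ∘ ⇑g := rfl
      rw [h, Set.image_comp, hg', hf']
  inv_mem' := by
    rintro f ⟨hf, hf'⟩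
    have h1 : ∀ x, f (f⁻¹ x) = x := fun x => f.apply_symm_apply x
    have h2 : ∀ x, f⁻¹ (f x) = x := fun x => f.symm_apply_apply x
    refine ⟨fun x y => f.injective ?_, ?_⟩
    · rw [hf, h1, h1, h1]
    · conv_lhs => rw [← hf']
      rw [← Set.image_comp]
      have h : ⇑f⁻¹ ∘ ⇑f = id := funext h2
      rw [h, Set.image_id]

/-! ### The split extension -/

/-- The elementary abelian group `2^3`, written multiplicatively. -/
abbrev ElemAbEight : Type := Multiplicative (Fin 3 → ZMod 2)

/-- The group `PSL_2(7)`. -/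
abbrev PSLTwoSeven : Type := Matrix.ProjectiveSpecialLinearGroup (Fin 2) (ZMod 7)

/-- The split extension `2^3:PSL_2(7)`: the semidirect product of `2^3` by `PSL_2(7)`, where
`PSL_2(7)` acts as the full automorphism group of `2^3` through the identification `φ`. -/
abbrev SplitExtension (φ : PSLTwoSeven ≃* MulAut ElemAbEight) : Type :=
  ElemAbEight ⋊[φ.toMonoidHom] PSLTwoSeven

/-! ### Characters and character tables -/

/-- `χ` is the character of an irreducible finite-dimensional complex representation of `G`. -/
def IsIrreducibleCharacter {G : Type} [Group G] (χ : G → ℂ) : Prop :=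
  ∃ (V : Type) (_ : AddCommGroup V) (_ : Module ℂ V) (_ : FiniteDimensional ℂ V)
    (ρ : Representation ℂ G V), ρ.IsIrreducible ∧ ρ.character = χ

/-- The set of irreducible complex characters of `G`. -/
abbrev IrreducibleCharacter (G : Type) [Group G] : Type :=
  {χ : G → ℂ // IsIrreducibleCharacter χ}

/-- `χ` is the character of a representation of `G` over the real numbers. -/
def IsAffordedOverReal {G : Type} [Group G] (χ : G → ℂ) : Prop :=
  ∃ (V : Type) (_ : AddCommGroup V) (_ : Module ℝ V) (_ : FiniteDimensional ℝ V)
    (ρ : Representation ℝ G V), ∀ g, χ g = ((ρ.character g : ℝ) : ℂ)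

/-- `T` is the character table of `G`, with class sizes `size` and element orders `ord`: the
columns of `T` can be matched bijectively with the conjugacy classes of `G`, and the rows with all
the irreducible complex characters of `G`, so that the `j`-th class has `size j` elements, each of
order `ord j`, and the `i`-th character takes the value `T i j` on the `j`-th class. -/
def HasCharacterTable (G : Type) [Group G] {n : ℕ} (T : Matrix (Fin n) (Fin n) ℂ)
    (size ord : Fin n → ℕ) : Prop :=
  ∃ (C : Fin n ≃ ConjClasses G) (χ : Fin n ≃ IrreducibleCharacter G),
    (∀ j, (C j).carrier.ncard = size j) ∧
    (∀ j, ∀ g ∈ (C j).carrier, orderOf g = ord j) ∧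
    (∀ i j, ∀ g ∈ (C j).carrier, (χ i).1 g = T i j)

/-- All irreducible complex representations of `G` are real (they can be written over `ℝ`), except
those of dimension `3`, whose characters are not even real-valued; two distinct irreducible
characters of degree `3` are complex conjugates of each other. -/
def RealExceptDegreeThree (G : Type) [Group G] : Prop :=
  (∀ χ : IrreducibleCharacter G, χ.1 1 ≠ 3 → IsAffordedOverReal χ.1) ∧
  (∀ χ : IrreducibleCharacter G, χ.1 1 = 3 → ∃ g, (χ.1 g).im ≠ 0) ∧
  (∀ χ ψ : IrreducibleCharacter G, χ.1 1 = 3 → ψ.1 1 = 3 → χ ≠ ψ →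
    ∀ g, ψ.1 g = (starRingEnd ℂ) (χ.1 g))

/-! ### The data of the table -/

/-- `η = (-1 + i √7) / 2`. -/
noncomputable def etaSeven : ℂ := (-1 + Complex.I * (Real.sqrt 7 : ℝ)) / 2

/-- `η̄ = (-1 - i √7) / 2`. -/
noncomputable def etaSevenBar : ℂ := (starRingEnd ℂ) etaSeven

/-- The common character table; rows `1, 3₁, 3₂, 6, 7₁, 7₂, 7₃, 8, 14, 21₁, 21₂`. -/
noncomputable def commonCharacterTable : Matrix (Fin 11) (Fin 11) ℂ :=
  !![ 1,  1,  1,  1,  1,  1,  1,  1,  1,  1,  1;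
      3,  3, -1,  0, -1, -1,  0, etaSeven, etaSevenBar,  1,  1;
      3,  3, -1,  0, -1, -1,  0, etaSevenBar, etaSeven,  1,  1;
      6,  6,  2,  0,  2,  2,  0, -1, -1,  0,  0;
      7, -1, -1,  1, -1,  3, -1,  0,  0,  1, -1;
      7,  7, -1,  1, -1, -1,  1,  0,  0, -1, -1;
      7, -1, -1,  1,  3, -1, -1,  0,  0, -1,  1;
      8,  8,  0, -1,  0,  0, -1,  1,  1,  0,  0;
     14, -2, -2, -1,  2,  2,  1,  0,  0,  0,  0;
     21, -3,  1,  0, -3,  1,  0,  0,  0, -1,  1;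
     21, -3,  1,  0,  1, -3,  0,  0,  0,  1, -1]

/-- The sizes of the conjugacy classes `C_1, …, C_11` (the same for both groups). -/
def commonClassSizes : Fin 11 → ℕ :=
  ![1, 7, 84, 224, 42, 42, 224, 192, 192, 168, 168]

/-- The orders of the elements of `C_1, …, C_11` in the non-split group `2^3.PSL_2(7)`. -/
def nonSplitClassOrders : Fin 11 → ℕ :=
  ![1, 2, 2, 3, 4, 4, 6, 7, 7, 8, 8]

/-- The orders of the elements of `C_1, …, C_11` in the split group `2^3:PSL_2(7)`. -/
def splitClassOrders : Fin 11 → ℕ :=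
  ![1, 2, 4, 3, 2, 2, 6, 7, 7, 4, 4]

/-!
Both groups have `1344` elements and act on eight points, up to signs: the non-split group on the
lines spanned by `1, e₁, …, e₇`, the split group as the affine group of the space `𝔽₂³`. Their
elements are therefore encoded by eight hexadecimal digits, a digit being a point together with a
sign. Every automorphism of the octonionic set is determined by the images of three units that
generate the algebra, so that both groups become explicit lists of codes (`affineCodes`,
`automorphismCodes`, with `AffineGroup.isCoding`, `octonionUnitAut.isCoding`), closed under
composition. On these lists the kernel counts centralizers of eleven representatives
(`isClassSystem_affineCodes`, `isClassSystem_automorphismCodes`). As the class sizes add up to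
`1344`, there are no other classes.

The characters are found without any construction of induced modules. The signed permutation
representation on the eight points is `1 + 7₁`. The linear parts act on the eight vectors of `𝔽₂³`,
which gives `2·1 + 6`. The symmetric squares of these representations yield `8` and one of `14`
and `21₁`, and all of this is defined over `ℝ`. Tensor products and the splitting off of irreducible
constituents, which is possible over `ℝ` by Maschke's theorem once the class functions are known
(`IsCharacterOver.sub`), then produce all rows except `3₁` and `3₂` (`table_of_generating_rows`).
The same procedure gives the real character `3₁ + 3₂` of norm two. Over `ℂ` it is the sum of two
irreducible characters, and these have to be the two rows of the table, because they are orthogonal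
to the other nine (`isCharacterOver_row`). By row orthogonality the rows are distinct irreducible
characters, and by column orthogonality they span the class functions, so there are no others.

The group `SL₂(7)` acts on the projective line over `𝔽₇`. With a suitable labelling of its eight
points by the vectors of `𝔽₂³`, the action is by affine maps, and taking linear parts gives the
isomorphism of `PSL₂(7)` with `Aut(2³)` (`pslEquivMulAut`). The changes of signs form a
self-centralizing normal subgroup `2³` of the group of automorphisms, on which conjugation therefore
induces a group of order `1344 / 8 = 168`, that is, `Aut(2³)` (`octonionUnitAut.extension`). The
extension does not split, because an element of order four of the quotient does not lift to an
element of order four. The two groups are not isomorphic since only one of them has elements of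
order eight.
-/

/-! ### Characters over a field of characteristic zero -/

section Characters

open Representation

/-- `χ` is the character of a finite-dimensional representation of `G` over `k`. -/
def IsCharacterOver (k : Type) [Field k] {G : Type} [Group G] (χ : G → k) : Prop :=
  ∃ (V : Type) (_ : AddCommGroup V) (_ : Module k V) (_ : FiniteDimensional k V)
    (ρ : Representation k G V), ρ.character = χ

/-- The pairing `|G|⁻¹ ∑ g, χ(g) ψ(g⁻¹)`; it is bilinear, also over `ℂ`. -/
noncomputable def charPairing {k : Type} [Field k] {G : Type} [Group G] [Fintype G]
    (χ ψ : G → k) : k :=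
  (Nat.card G : k)⁻¹ * ∑ g, χ g * ψ g⁻¹

variable {k : Type} [Field k] {G : Type} [Group G]
  {V W : Type} [AddCommGroup V] [Module k V] [FiniteDimensional k V]
  [AddCommGroup W] [Module k W] [FiniteDimensional k W]

theorem IsCharacterOver.mul {χ ψ : G → k} (hχ : IsCharacterOver k χ) (hψ : IsCharacterOver k ψ) :
    IsCharacterOver k (χ * ψ) := by
  obtain ⟨V, _, _, _, ρ, rfl⟩ := hχ
  obtain ⟨W, _, _, _, σ, rfl⟩ := hψ
  exact ⟨_, _, _, inferInstance, ρ.tprod σ, char_tensor ρ σ⟩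

theorem IsCharacterOver.conj_eq {χ : G → k} (hχ : IsCharacterOver k χ) {g h : G}
    (hgh : IsConj g h) : χ g = χ h := by
  obtain ⟨V, _, _, _, ρ, rfl⟩ := hχ
  obtain ⟨c, rfl⟩ := isConj_iff.1 hgh
  exact (char_conj ρ g c).symm

theorem isCharacterOver_one : IsCharacterOver k (1 : G → k) :=
  ⟨k, _, _, inferInstance, Representation.trivial k G k, by
    ext g; simp [character, Representation.trivial]⟩

theorem IsCharacterOver.baseChange {χ : G → ℝ} (hχ : IsCharacterOver ℝ χ) :
    IsCharacterOver ℂ (fun g => (χ g : ℂ)) := by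
  obtain ⟨V, _, _, _, ρ, rfl⟩ := hχ
  refine ⟨TensorProduct ℝ ℂ V, _, _, inferInstance,
    { toFun := fun g => (ρ g).baseChange ℂ
      map_one' := by simp [Module.End.one_eq_id]
      map_mul' := fun g h => by simp [Module.End.mul_eq_comp, LinearMap.baseChange_comp] }, ?_⟩
  ext g
  exact LinearMap.trace_baseChange (ρ g) ℂ

/-- Complementary subrepresentations: the character is the sum of the two partial characters. -/
theorem character_eq_add_of_isCompl {ρ : Representation k G V} {U U' : Subrepresentation ρ}
    (h : IsCompl U U') :
    ρ.character = U.toRepresentation.character + U'.toRepresentation.character := by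
  have h' : IsCompl U.toSubmodule U'.toSubmodule := by
    constructor
    · rw [disjoint_iff, ← Subrepresentation.toSubmodule_inf, h.inf_eq_bot]; rfl
    · rw [codisjoint_iff, ← Subrepresentation.toSubmodule_sup, h.sup_eq_top]; rfl
  ext g
  have key : ρ g = (Submodule.prodEquivOfIsCompl _ _ h').conj
      (LinearMap.prodMap (U.toRepresentation g) (U'.toRepresentation g)) := by
    apply LinearMap.ext
    intro v
    obtain ⟨⟨u, u'⟩, rfl⟩ := (Submodule.prodEquivOfIsCompl _ _ h').surjective v
    rw [LinearEquiv.conj_apply_apply, LinearEquiv.symm_apply_apply, LinearMap.prodMap_apply,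
      Submodule.coe_prodEquivOfIsCompl', Submodule.coe_prodEquivOfIsCompl', map_add]
    rfl
  simp only [character, Pi.add_apply]
  rw [key, LinearMap.trace_conj', LinearMap.trace_prodMap']

variable [Fintype G] [CharZero k]

theorem charPairing_eq_finrank (ρ : Representation k G V) (σ : Representation k G W) :
    charPairing σ.character ρ.character = Module.finrank k (IntertwiningMap ρ σ) := by
  have : Invertible (Nat.card G : k) :=
    invertibleOfNonzero (Nat.cast_ne_zero.2 Nat.card_pos.ne')
  exact card_inv_mul_sum_char_mul_char_eq_finrank ρ σ

theorem IsCharacterOver.pairing_natCast {χ ψ : G → k} (hχ : IsCharacterOver k χ)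
    (hψ : IsCharacterOver k ψ) : ∃ n : ℕ, charPairing χ ψ = n := by
  obtain ⟨V, _, _, _, ρ, rfl⟩ := hχ
  obtain ⟨W, _, _, _, σ, rfl⟩ := hψ
  exact ⟨_, charPairing_eq_finrank σ ρ⟩

/-- A representation whose only endomorphisms are the scalars is irreducible: by Maschke's theorem
a subrepresentation is the image of an equivariant projection, which has to be `0` or `1`. -/
theorem isIrreducible_of_pairing_self {ρ : Representation k G V}
    (h : charPairing ρ.character ρ.character = 1) : ρ.IsIrreducible := by
  have h1 : Module.finrank k (IntertwiningMap ρ ρ) = 1 := by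
    rw [charPairing_eq_finrank] at h; exact_mod_cast h
  have hne : Nontrivial V := by
    by_contra hV
    rw [not_nontrivial_iff_subsingleton] at hV
    have : Subsingleton (IntertwiningMap ρ ρ) :=
      ⟨fun f g => by ext v; exact Subsingleton.elim _ _⟩
    rw [Module.finrank_zero_of_subsingleton] at h1
    exact zero_ne_one h1
  have hid : (IntertwiningMap.id ρ) ≠ 0 := by
    intro h0
    obtain ⟨v, hv⟩ := exists_ne (0 : V)
    exact hv (by simpa using DFunLike.congr_fun h0 v)
  have hbt : (⊥ : Subrepresentation ρ) ≠ ⊤ := fun h0 =>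
    bot_ne_top (α := Submodule k V) (congrArg Subrepresentation.toSubmodule h0)
  have : Nontrivial (Subrepresentation ρ) := ⟨_, _, hbt⟩
  refine ⟨fun U => ?_⟩
  obtain ⟨U', hU⟩ := exists_isCompl U
  have h' : IsCompl U.toSubmodule U'.toSubmodule := by
    constructor
    · rw [disjoint_iff, ← Subrepresentation.toSubmodule_inf, hU.inf_eq_bot]; rfl
    · rw [codisjoint_iff, ← Subrepresentation.toSubmodule_sup, hU.sup_eq_top]; rfl
  let p : IntertwiningMap ρ ρ :=
    LinearMap.intertwiningMap_of_isIntertwiningMap ρ ρ (U.toSubmodule.projection _ h') <| by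
      intro g v
      obtain ⟨u, u', rfl, -⟩ := Submodule.existsUnique_add_of_isCompl h' v
      have e1 := Submodule.projection_apply_of_mem_left h' (U.apply_mem_toSubmodule g u.2)
      have e2 : U.toSubmodule.projection _ h' (ρ g u') = 0 := by
        simpa using U'.apply_mem_toSubmodule g u'.2
      have e3 : U.toSubmodule.projection _ h' (u' : V) = 0 := by simp
      simp only [map_add, e1, e2, e3, Submodule.projection_apply_left, map_zero]
  obtain ⟨c, hc⟩ := (finrank_eq_one_iff_of_nonzero' _ hid).1 h1 p
  have hc' : ∀ v, U.toSubmodule.projection _ h' v = c • v := fun v =>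
    (DFunLike.congr_fun hc v).symm
  by_cases h0 : c = 0
  · left
    apply Subrepresentation.toSubmodule_injective
    refine (Submodule.eq_bot_iff _).2 fun u hu => ?_
    have := Submodule.projection_apply_of_mem_left h' hu
    rw [hc', h0, zero_smul] at this
    exact this.symm
  · right
    apply Subrepresentation.toSubmodule_injective
    refine Submodule.eq_top_iff'.2 fun v => ?_
    have : c • v ∈ U.toSubmodule := hc' v ▸ Submodule.projection_apply_mem h' v
    exact (Submodule.smul_mem_iff _ h0).1 this

/-- An irreducible constituent can be split off from a character, over any field of
characteristic zero: this is how all real representations below are obtained. -/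
theorem IsCharacterOver.sub {χ ψ : G → k} (hχ : IsCharacterOver k χ) (hψ : IsCharacterOver k ψ)
    (h1 : charPairing ψ ψ = 1) (h0 : charPairing χ ψ ≠ 0) : IsCharacterOver k (χ - ψ) := by
  obtain ⟨V, _, _, _, ρ, rfl⟩ := hχ
  obtain ⟨W, _, _, _, σ, rfl⟩ := hψ
  have := isIrreducible_of_pairing_self h1
  rw [charPairing_eq_finrank, Nat.cast_ne_zero] at h0
  obtain ⟨f, hf⟩ := (Module.finrank_pos_iff_exists_ne_zero (R := k)).1 (Nat.pos_of_ne_zero h0)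
  have hinj := (IsIrreducible.injective_or_eq_zero f).resolve_right hf
  obtain ⟨U, hU⟩ := exists_isCompl f.range
  have e : σ.Equiv f.range.toRepresentation :=
    Representation.Equiv.mk (LinearEquiv.ofInjective f.toLinearMap hinj) fun g => by
      ext v
      exact IntertwiningMap.isIntertwining _ _ f g v
  refine ⟨U.toSubmodule, _, _, inferInstance, U.toRepresentation, ?_⟩
  rw [character_eq_add_of_isCompl hU, char_iso e, add_sub_cancel_left]

omit [CharZero k] in
theorem charPairing_add_left (χ χ' ψ : G → k) :
    charPairing (χ + χ') ψ = charPairing χ ψ + charPairing χ' ψ := by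
  simp [charPairing, add_mul, Finset.sum_add_distrib, mul_add]

omit [CharZero k] in
theorem charPairing_add_right (χ ψ ψ' : G → k) :
    charPairing χ (ψ + ψ') = charPairing χ ψ + charPairing χ ψ' := by
  simp [charPairing, mul_add, Finset.sum_add_distrib]

/-- A character of norm two over an algebraically closed field is the sum of two distinct
irreducible ones. -/
theorem IsCharacterOver.exists_add_of_pairing_self_eq_two [IsAlgClosed k] {χ : G → k}
    (hχ : IsCharacterOver k χ) (h2 : charPairing χ χ = 2) :
    ∃ α β : G → k, IsCharacterOver k α ∧ IsCharacterOver k β ∧ χ = α + β ∧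
      charPairing α α = 1 ∧ charPairing β β = 1 ∧ charPairing α β = 0 := by
  obtain ⟨V, _, _, _, ρ, rfl⟩ := hχ
  have hpos : ∀ U : Subrepresentation ρ, U ≠ ⊥ →
      0 < Module.finrank k (IntertwiningMap U.toRepresentation U.toRepresentation) := by
    intro U hU
    refine (Module.finrank_pos_iff_exists_ne_zero (R := k)).2
      ⟨IntertwiningMap.id _, fun h0 => hU ?_⟩
    apply Subrepresentation.toSubmodule_injective
    refine (Submodule.eq_bot_iff _).2 fun u hu => ?_
    exact congrArg Subtype.val (DFunLike.congr_fun h0 (⟨u, hu⟩ : U.toSubmodule))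
  have hirr : ¬ ρ.IsIrreducible := by
    intro hi
    rw [charPairing_eq_finrank, IsIrreducible.finrank_intertwiningMap_self] at h2
    norm_num at h2
  have hbt : (⊥ : Subrepresentation ρ) ≠ ⊤ := by
    intro h0
    have hs : Subsingleton V := (Submodule.subsingleton_iff k).1 <|
      subsingleton_of_bot_eq_top (congrArg Subrepresentation.toSubmodule h0)
    have : Subsingleton (IntertwiningMap ρ ρ) :=
      ⟨fun f g => by ext v; exact Subsingleton.elim _ _⟩
    rw [charPairing_eq_finrank, Module.finrank_zero_of_subsingleton] at h2
    norm_num at h2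
  obtain ⟨U, hUb, hUt⟩ : ∃ U : Subrepresentation ρ, U ≠ ⊥ ∧ U ≠ ⊤ := by
    by_contra! hc
    have : Nontrivial (Subrepresentation ρ) := ⟨_, _, hbt⟩
    exact hirr ⟨fun U => or_iff_not_imp_left.2 (hc U)⟩
  obtain ⟨U', hU⟩ := exists_isCompl U
  have hUb' : U' ≠ ⊥ := fun h0 => hUt (by simpa [h0] using hU.sup_eq_top)
  have hs := character_eq_add_of_isCompl hU
  have h11 := charPairing_eq_finrank U.toRepresentation U.toRepresentation
  have h22 := charPairing_eq_finrank U'.toRepresentation U'.toRepresentation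
  have h12 := charPairing_eq_finrank U'.toRepresentation U.toRepresentation
  have h21 := charPairing_eq_finrank U.toRepresentation U'.toRepresentation
  have p1 := hpos U hUb
  have p2 := hpos U' hUb'
  rw [hs, charPairing_add_left, charPairing_add_right, charPairing_add_right, h11, h22, h12, h21]
    at h2
  norm_cast at h2
  refine ⟨_, _, ⟨_, _, _, inferInstance, U.toRepresentation, rfl⟩,
    ⟨_, _, _, inferInstance, U'.toRepresentation, rfl⟩, hs, ?_, ?_, ?_⟩
  · rw [h11, Nat.cast_eq_one]; omega
  · rw [h22, Nat.cast_eq_one]; omega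
  · rw [h12, Nat.cast_eq_zero]; omega

theorem IsCharacterOver.isIrreducibleCharacter {χ : G → ℂ} (hχ : IsCharacterOver ℂ χ)
    (h : charPairing χ χ = 1) : IsIrreducibleCharacter χ := by
  obtain ⟨V, _, _, _, ρ, rfl⟩ := hχ
  exact ⟨V, _, _, inferInstance, ρ, isIrreducible_of_pairing_self h, rfl⟩

omit [Fintype G] in
theorem IsIrreducibleCharacter.isCharacterOver {χ : G → ℂ} (hχ : IsIrreducibleCharacter χ) :
    IsCharacterOver ℂ χ := by
  obtain ⟨V, _, _, _, ρ, -, h⟩ := hχ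
  exact ⟨V, _, _, inferInstance, ρ, h⟩

theorem IsIrreducibleCharacter.pairing_self {χ : G → ℂ} (hχ : IsIrreducibleCharacter χ) :
    charPairing χ χ = 1 := by
  obtain ⟨V, _, _, _, ρ, hρ, rfl⟩ := hχ
  rw [charPairing_eq_finrank, IsIrreducible.finrank_intertwiningMap_self, Nat.cast_one]

theorem IsIrreducibleCharacter.pairing_eq_zero {χ ψ : G → ℂ} (hχ : IsIrreducibleCharacter χ)
    (hψ : IsIrreducibleCharacter ψ) (hne : χ ≠ ψ) : charPairing χ ψ = 0 := by
  obtain ⟨V, _, _, _, ρ, hρ, rfl⟩ := hχ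
  obtain ⟨W, _, _, _, σ, hσ, rfl⟩ := hψ
  have : IsEmpty (Representation.Equiv σ ρ) := ⟨fun e => hne (char_iso e).symm⟩
  rw [charPairing_eq_finrank, Module.finrank_zero_of_subsingleton, Nat.cast_zero]

end Characters

/-! ### Class functions on a group with the eleven classes of the table -/

section ClassFunctions

/-- The effect of inversion on the eleven classes: the two classes of elements of order `7` are
swapped, all other classes are real. -/
def invClass (j : Fin 11) : Fin 11 := Equiv.swap 7 8 j

/-- `cls` labels the conjugacy classes of `G` by the columns of the table, compatibly with
sizes and inversion. -/
structure IsClassLabelling {G : Type} [Group G] (cls : G → Fin 11) : Prop where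
  isConj_iff : ∀ g h, IsConj g h ↔ cls g = cls h
  ncard_eq : ∀ j, {g | cls g = j}.ncard = commonClassSizes j
  map_one : cls 1 = 0
  map_inv : ∀ g, cls g⁻¹ = invClass (cls g)

/-- `1344` times the pairing of two class functions, in terms of their values on the classes. -/
def rowPairing {R : Type*} [CommRing R] (r s : Fin 11 → R) : R :=
  ∑ j, (commonClassSizes j : R) * (r j * s (invClass j))

/-- The integral part of the table: its entries are `tableInt i j + tableEta i j * η`. -/
def tableInt : Fin 11 → Fin 11 → ℤ :=
  ![![1, 1, 1, 1, 1, 1, 1, 1, 1, 1, 1],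
    ![3, 3, -1, 0, -1, -1, 0, 0, -1, 1, 1],
    ![3, 3, -1, 0, -1, -1, 0, -1, 0, 1, 1],
    ![6, 6, 2, 0, 2, 2, 0, -1, -1, 0, 0],
    ![7, -1, -1, 1, -1, 3, -1, 0, 0, 1, -1],
    ![7, 7, -1, 1, -1, -1, 1, 0, 0, -1, -1],
    ![7, -1, -1, 1, 3, -1, -1, 0, 0, -1, 1],
    ![8, 8, 0, -1, 0, 0, -1, 1, 1, 0, 0],
    ![14, -2, -2, -1, 2, 2, 1, 0, 0, 0, 0],
    ![21, -3, 1, 0, -3, 1, 0, 0, 0, -1, 1],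
    ![21, -3, 1, 0, 1, -3, 0, 0, 0, 1, -1]]

/-- The coefficients of `η` in the table. -/
def tableEta : Fin 11 → Fin 11 → ℤ :=
  ![0, ![0, 0, 0, 0, 0, 0, 0, 1, -1, 0, 0], ![0, 0, 0, 0, 0, 0, 0, -1, 1, 0, 0],
    0, 0, 0, 0, 0, 0, 0, 0]

theorem etaSeven_sq : etaSeven ^ 2 = -etaSeven - 2 := by
  have h7 : ((Real.sqrt 7 : ℝ) : ℂ) ^ 2 = 7 := by
    rw [← Complex.ofReal_pow, Real.sq_sqrt (by norm_num)]; norm_num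
  rw [etaSeven]
  linear_combination (1 / 4 * Complex.I ^ 2) * h7 + 7 / 4 * Complex.I_sq

theorem etaSevenBar_eq : etaSevenBar = -1 - etaSeven := by
  simp only [etaSevenBar, etaSeven, map_div₀, map_add, map_neg, map_one, map_mul, Complex.conj_I,
    Complex.conj_ofReal, map_ofNat]
  ring

theorem etaSeven_im_ne_zero : etaSeven.im ≠ 0 := by
  have h : etaSeven.im = Real.sqrt 7 / 2 := by
    have h2 : etaSeven = ((-1 / 2 : ℝ) : ℂ) + ((Real.sqrt 7 / 2 : ℝ) : ℂ) * Complex.I := by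
      rw [etaSeven]; push_cast; ring
    rw [h2]
    simp only [Complex.add_im, Complex.ofReal_im, Complex.im_ofReal_mul, Complex.I_im]
    ring
  rw [h]
  positivity

theorem commonCharacterTable_apply (i j : Fin 11) :
    commonCharacterTable i j = (tableInt i j : ℂ) + (tableEta i j : ℂ) * etaSeven := by
  fin_cases i <;> fin_cases j <;>
    simp [commonCharacterTable, tableInt, tableEta, etaSevenBar_eq] <;> ring

/-- Row orthogonality. -/
theorem rowPairing_commonCharacterTable (i k : Fin 11) :
    rowPairing (commonCharacterTable i) (commonCharacterTable k) = if i = k then 1344 else 0 := by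
  have e : rowPairing (commonCharacterTable i) (commonCharacterTable k) =
      ((rowPairing (tableInt i) (tableInt k) - 2 * rowPairing (tableEta i) (tableEta k) : ℤ) : ℂ) +
      ((rowPairing (tableInt i) (tableEta k) + rowPairing (tableEta i) (tableInt k) -
        rowPairing (tableEta i) (tableEta k) : ℤ) : ℂ) * etaSeven := by
    simp only [rowPairing, commonCharacterTable_apply]
    push_cast
    simp only [Finset.mul_sum, ← Finset.sum_sub_distrib, ← Finset.sum_add_distrib, Finset.sum_mul]
    refine Finset.sum_congr rfl fun j _ => ?_
    linear_combination ((commonClassSizes j : ℂ) * tableEta i j * tableEta k (invClass j)) *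
      etaSeven_sq
  have h1 : ∀ i k, rowPairing (tableInt i) (tableInt k) -
      2 * rowPairing (tableEta i) (tableEta k) = if i = k then 1344 else 0 := by decide +kernel
  have h2 : ∀ i k, rowPairing (tableInt i) (tableEta k) + rowPairing (tableEta i) (tableInt k) -
      rowPairing (tableEta i) (tableEta k) = 0 := by decide +kernel
  rw [e, h1, h2]
  split_ifs <;> simp

/-- The rows of the table form a basis of the class functions: column orthogonality gives the
expansion of a class function in the rows. -/
theorem eq_sum_rowPairing (f : Fin 11 → ℂ) (j : Fin 11) :
    f j = ∑ k, rowPairing (commonCharacterTable k) f / 1344 * commonCharacterTable k j := by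
  let M : Matrix (Fin 11) (Fin 11) ℂ :=
    .of fun i j => (commonClassSizes j : ℂ) * commonCharacterTable i j / 1344
  let N : Matrix (Fin 11) (Fin 11) ℂ := .of fun j k => commonCharacterTable k (invClass j)
  have hMN : M * N = 1 := by
    ext i k
    have h := rowPairing_commonCharacterTable i k
    rw [Matrix.mul_apply, Matrix.one_apply]
    have : ∑ j, M i j * N j k =
        rowPairing (commonCharacterTable i) (commonCharacterTable k) / 1344 := by
      rw [rowPairing, Finset.sum_div]
      refine Finset.sum_congr rfl fun j _ => ?_
      simp only [M, N, Matrix.of_apply]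
      ring
    rw [this, h]
    split_ifs <;> simp
  have hNM : N * M = 1 := mul_eq_one_comm.1 hMN
  have hinv : ∀ j, invClass (invClass j) = j := by decide
  have h1 := congrFun (congrArg (fun A => A.mulVec (fun j => f (invClass j))) hNM) (invClass j)
  simp only [Matrix.one_mulVec, ← Matrix.mulVec_mulVec, hinv] at h1
  rw [← h1, Matrix.mulVec, dotProduct]
  refine Finset.sum_congr rfl fun k _ => ?_
  rw [Matrix.mulVec, dotProduct, rowPairing, Finset.sum_div, mul_comm]
  simp only [N, M, Matrix.of_apply, hinv]
  congr 1
  refine Finset.sum_congr rfl fun j _ => ?_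
  ring

variable {G : Type} [Group G] {cls : G → Fin 11}

namespace IsClassLabelling

theorem surjective (h : IsClassLabelling cls) : Function.Surjective cls := by
  intro j
  have hpos : ∀ j, commonClassSizes j ≠ 0 := by decide
  obtain ⟨g, hg⟩ := Set.nonempty_of_ncard_ne_zero (h.ncard_eq j ▸ hpos j)
  exact ⟨g, hg⟩

theorem sum_comp [Fintype G] (h : IsClassLabelling cls) {k : Type} [Field k] (f : Fin 11 → k) :
    ∑ g, f (cls g) = ∑ j, (commonClassSizes j : k) * f j := by
  classical
  rw [← Finset.sum_fiberwise (s := Finset.univ) (g := cls)]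
  refine Finset.sum_congr rfl fun j _ => ?_
  rw [Finset.sum_congr rfl (g := fun _ => f j) fun g hg => by rw [(Finset.mem_filter.1 hg).2],
    Finset.sum_const, nsmul_eq_mul, ← h.ncard_eq j, Set.ncard_eq_toFinset_card']
  simp

theorem card_eq [Fintype G] (h : IsClassLabelling cls) : Nat.card G = 1344 := by
  have := h.sum_comp (fun _ => (1 : ℚ))
  have h2 : (∑ j, (commonClassSizes j : ℚ) * 1) = 1344 := by
    simp [Fin.sum_univ_succ, commonClassSizes]; norm_num
  rw [h2] at this
  rw [Nat.card_eq_fintype_card]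
  simp only [Finset.sum_const, Finset.card_univ, nsmul_eq_mul, mul_one] at this
  exact_mod_cast this

theorem charPairing_comp [Fintype G] (h : IsClassLabelling cls) {k : Type} [Field k]
    (r s : Fin 11 → k) :
    charPairing (fun g => r (cls g)) (fun g => s (cls g)) = rowPairing r s / 1344 := by
  rw [charPairing, h.card_eq, rowPairing, ← h.sum_comp fun j => r j * s (invClass j),
    div_eq_inv_mul]
  simp [h.map_inv]

theorem exists_eq_comp {k : Type} [Field k] (h : IsClassLabelling cls) {χ : G → k}
    (hχ : IsCharacterOver k χ) : ∃ f : Fin 11 → k, χ = fun g => f (cls g) := by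
  refine ⟨fun j => χ (Function.surjInv h.surjective j), funext fun g => hχ.conj_eq ?_⟩
  rw [h.isConj_iff, Function.surjInv_eq h.surjective]

end IsClassLabelling

/-- The integral row `r` is the character of a real representation. -/
def RowIsReal (cls : G → Fin 11) (r : Fin 11 → ℤ) : Prop :=
  IsCharacterOver ℝ (fun g => (r (cls g) : ℝ))

theorem rowIsReal_zero : RowIsReal cls (tableInt 0) := by
  have e : tableInt 0 = fun _ => 1 := by decide
  have := isCharacterOver_one (k := ℝ) (G := G)
  rw [RowIsReal, e]
  simpa [Pi.one_def] using this

theorem RowIsReal.mul {r s : Fin 11 → ℤ} (hr : RowIsReal cls r) (hs : RowIsReal cls s) :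
    RowIsReal cls (r * s) := by
  have := IsCharacterOver.mul hr hs
  simpa [RowIsReal, Pi.mul_def] using this

theorem RowIsReal.sub [Fintype G] (h : IsClassLabelling cls) {r s : Fin 11 → ℤ}
    (hr : RowIsReal cls r) (hs : RowIsReal cls s) (h1 : rowPairing s s = 1344)
    (h0 : rowPairing r s ≠ 0) : RowIsReal cls (r - s) := by
  have cast (r s : Fin 11 → ℤ) :
      rowPairing (fun j => (r j : ℝ)) (fun j => (s j : ℝ)) = (rowPairing r s : ℤ) := by
    simp [rowPairing]
  have := IsCharacterOver.sub hr hs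
    (by rw [h.charPairing_comp (fun j => (s j : ℝ)) (fun j => (s j : ℝ)), cast, h1]; norm_num)
    (by
      rw [h.charPairing_comp (fun j => (r j : ℝ)) (fun j => (s j : ℝ)), cast]
      exact div_ne_zero (Int.cast_ne_zero.2 h0) (by norm_num))
  simpa [RowIsReal, Pi.sub_def] using this

theorem RowIsReal.isCharacterOver_complex {i : Fin 11} (hi : tableEta i = 0)
    (hr : RowIsReal cls (tableInt i)) :
    IsCharacterOver ℂ (fun g => commonCharacterTable i (cls g)) := by
  have := IsCharacterOver.baseChange hr
  simpa [commonCharacterTable_apply, hi] using this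

theorem isIrreducibleCharacter_row [Fintype G] (h : IsClassLabelling cls) {i : Fin 11}
    (hi : IsCharacterOver ℂ (fun g => commonCharacterTable i (cls g))) :
    IsIrreducibleCharacter (fun g => commonCharacterTable i (cls g)) := by
  refine hi.isIrreducibleCharacter ?_
  rw [h.charPairing_comp, rowPairing_commonCharacterTable]
  norm_num

theorem charPairing_comm [Fintype G] {k : Type} [Field k] (χ ψ : G → k) :
    charPairing χ ψ = charPairing ψ χ := by
  rw [charPairing, charPairing, ← Equiv.sum_comp (Equiv.inv G)]
  simp [mul_comm]

/-- Only the rows `χ^[3₁]` and `χ^[3₂]` are in question. They come together, as the real character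
`χ^[3₁] + χ^[3₂]`. Over `ℂ` it is a sum `α + β` of two irreducible characters, and `α`, orthogonal
to the other nine rows, is a combination `a χ^[3₁] + b χ^[3₂]` with `a + b = 1` and
`a ^ 2 + b ^ 2 = 1`. -/
theorem isCharacterOver_row [Fintype G] (h : IsClassLabelling cls)
    (hi : ∀ i, tableEta i = 0 → RowIsReal cls (tableInt i))
    (h33 : RowIsReal cls ![6, 6, -2, 0, -2, -2, 0, -1, -1, 2, 2]) (i : Fin 11) :
    IsCharacterOver ℂ (fun g => commonCharacterTable i (cls g)) := by
  by_cases hz : tableEta i = 0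
  · exact (hi i hz).isCharacterOver_complex hz
  let χ : Fin 11 → G → ℂ := fun i g => commonCharacterTable i (cls g)
  have hχ : ∀ i k, charPairing (χ i) (χ k) = if i = k then 1 else 0 := fun i k => by
    rw [h.charPairing_comp, rowPairing_commonCharacterTable]
    split_ifs <;> simp
  have hΦ : IsCharacterOver ℂ (χ 1 + χ 2) := by
    have := IsCharacterOver.baseChange h33
    convert this using 1
    ext g
    have hs : ∀ j, tableInt 1 j + tableInt 2 j =
        (![6, 6, -2, 0, -2, -2, 0, -1, -1, 2, 2] : Fin 11 → ℤ) j := by decide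
    have hs' : ∀ j, tableEta 1 j + tableEta 2 j = 0 := by decide
    simp only [χ, Pi.add_apply, commonCharacterTable_apply, ← hs]
    have := hs' (cls g)
    push_cast
    have : (tableEta 1 (cls g) : ℂ) + tableEta 2 (cls g) = 0 := by exact_mod_cast this
    linear_combination etaSeven * this
  have h2 : charPairing (χ 1 + χ 2) (χ 1 + χ 2) = 2 := by
    rw [charPairing_add_left, charPairing_add_right, charPairing_add_right]
    simp [hχ]; norm_num
  obtain ⟨α, β, hα, hβ, hs, hαα, hββ, hαβ⟩ := hΦ.exists_add_of_pairing_self_eq_two h2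
  have key : ∀ α β : G → ℂ, IsCharacterOver ℂ α → IsCharacterOver ℂ β → χ 1 + χ 2 = α + β →
      charPairing α α = 1 → charPairing α β = 0 → α = χ 1 ∨ α = χ 2 := by
    intro α β hα hβ hs hαα hαβ
    obtain ⟨f, hf⟩ := h.exists_eq_comp hα
    have hort : ∀ k, k ≠ 1 → k ≠ 2 → charPairing α (χ k) = 0 := by
      intro k k1 k2
      have hk0 : ∀ k : Fin 11, k ≠ 1 → k ≠ 2 → tableEta k = 0 := by decide
      have hk := (hi k (hk0 k k1 k2)).isCharacterOver_complex (hk0 k k1 k2)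
      obtain ⟨m, hm⟩ := hα.pairing_natCast hk
      obtain ⟨n, hn⟩ := hβ.pairing_natCast hk
      have h0 : charPairing α (χ k) + charPairing β (χ k) = 0 := by
        rw [← charPairing_add_left, ← hs, charPairing_add_left, hχ, hχ, if_neg k1.symm,
          if_neg k2.symm, add_zero]
      rw [show charPairing α (χ k) = m from hm, show charPairing β (χ k) = n from hn] at h0
      have : m = 0 := by norm_cast at h0; omega
      rw [show charPairing α (χ k) = m from hm, this, Nat.cast_zero]
    have hexp : α = charPairing α (χ 1) • χ 1 + charPairing α (χ 2) • χ 2 := by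
      have hc : ∀ k, rowPairing (commonCharacterTable k) f / 1344 = charPairing α (χ k) := by
        intro k
        rw [charPairing_comm, hf]
        exact (h.charPairing_comp _ _).symm
      ext g
      simp only [Pi.add_apply, Pi.smul_apply, smul_eq_mul]
      conv_lhs => rw [hf]
      simp only
      rw [eq_sum_rowPairing f (cls g)]
      simp only [hc]
      rw [← Finset.sum_subset (Finset.subset_univ {1, 2})]
      · rw [Finset.sum_pair (by decide)]
      · intro k _ hk
        simp only [Finset.mem_insert, Finset.mem_singleton, not_or] at hk
        rw [hort k hk.1 hk.2, zero_mul]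
    generalize ha : charPairing α (χ 1) = a at hexp
    generalize hb : charPairing α (χ 2) = b at hexp
    have hsum : a + b = 1 := by
      rw [← ha, ← hb, ← charPairing_add_right, hs, charPairing_add_right, hαα, hαβ, add_zero]
    have hsq : a * a + b * b = 1 := by
      rw [← hαα]
      conv_rhs => rw [charPairing]; enter [2, 2, g, 1]; rw [hexp]
      rw [charPairing] at ha hb
      simp only [Pi.add_apply, Pi.smul_apply, smul_eq_mul, add_mul, Finset.sum_add_distrib, mul_add]
      have e1 := charPairing_comm (χ 1) α
      have e2 := charPairing_comm (χ 2) α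
      simp only [charPairing] at e1 e2
      rw [← e1] at ha
      rw [← e2] at hb
      simp only [mul_assoc, ← Finset.mul_sum]
      linear_combination (-a) * ha - b * hb
    have hab : a * b = 0 := by linear_combination (1 / 2) * (a + b + 1) * hsum - (1 / 2) * hsq
    rcases mul_eq_zero.1 hab with h0 | h0
    · right
      rw [hexp, h0, show b = 1 by linear_combination hsum - h0, zero_smul, one_smul, zero_add]
    · left
      rw [hexp, h0, show a = 1 by linear_combination hsum - h0, zero_smul, one_smul, add_zero]
  have h12 : IsCharacterOver ℂ (χ 1) ∧ IsCharacterOver ℂ (χ 2) := by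
    rcases key α β hα hβ hs hαα hαβ with rfl | rfl
    · rw [add_right_inj] at hs
      exact ⟨hα, hs ▸ hβ⟩
    · rw [add_comm, add_right_inj] at hs
      exact ⟨hs ▸ hβ, hα⟩
  have hi12 : ∀ i : Fin 11, tableEta i ≠ 0 → i = 1 ∨ i = 2 := by decide
  rcases hi12 i hz with rfl | rfl
  exacts [h12.1, h12.2]

theorem IsClassLabelling.mem_carrier_iff (h : IsClassLabelling cls) (j : Fin 11) (g : G) :
    g ∈ (ConjClasses.mk (Function.surjInv h.surjective j)).carrier ↔ cls g = j := by
  rw [ConjClasses.mem_carrier_iff_mk_eq, ConjClasses.mk_eq_mk_iff_isConj, h.isConj_iff,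
    Function.surjInv_eq h.surjective]

/-- Every irreducible character is a row of the table: otherwise it would be orthogonal to all
rows, which form a basis of the class functions. -/
theorem exists_row_eq [Fintype G] (h : IsClassLabelling cls)
    (hrow : ∀ i, IsCharacterOver ℂ (fun g => commonCharacterTable i (cls g))) {χ : G → ℂ}
    (hχ : IsIrreducibleCharacter χ) : ∃ i, (fun g => commonCharacterTable i (cls g)) = χ := by
  by_contra! hne
  obtain ⟨f, rfl⟩ := h.exists_eq_comp hχ.isCharacterOver
  have h0 : ∀ k, rowPairing (commonCharacterTable k) f / 1344 = 0 := fun k => by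
    rw [← h.charPairing_comp]
    exact (isIrreducibleCharacter_row h (hrow k)).pairing_eq_zero hχ (hne k)
  have hf : ∀ j, f j = 0 := fun j => by
    rw [eq_sum_rowPairing f j]
    simp only [h0, zero_mul, Finset.sum_const_zero]
  have := hχ.pairing_self
  simp [charPairing, hf] at this

theorem hasCharacterTable_of_rows [Fintype G] (h : IsClassLabelling cls)
    (hrow : ∀ i, IsCharacterOver ℂ (fun g => commonCharacterTable i (cls g)))
    {ord : Fin 11 → ℕ} (hord : ∀ g, orderOf g = ord (cls g)) :
    HasCharacterTable G commonCharacterTable commonClassSizes ord := by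
  refine ⟨Equiv.ofBijective (fun j => ConjClasses.mk (Function.surjInv h.surjective j)) ⟨?_, ?_⟩,
    Equiv.ofBijective (fun i => ⟨fun g => commonCharacterTable i (cls g),
      isIrreducibleCharacter_row h (hrow i)⟩) ⟨?_, ?_⟩, ?_, ?_, ?_⟩
  · intro i j hij
    rw [ConjClasses.mk_eq_mk_iff_isConj, h.isConj_iff] at hij
    simpa [Function.surjInv_eq h.surjective] using hij
  · intro c
    obtain ⟨g, rfl⟩ := ConjClasses.mk_surjective c
    refine ⟨cls g, ?_⟩
    rw [ConjClasses.mk_eq_mk_iff_isConj, h.isConj_iff, Function.surjInv_eq h.surjective]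
  · intro i k hik
    have e : (fun g => commonCharacterTable i (cls g)) = fun g => commonCharacterTable k (cls g) :=
      congrArg Subtype.val hik
    have h1 := h.charPairing_comp (commonCharacterTable i) (commonCharacterTable i)
    conv_lhs at h1 => arg 2; rw [e]
    rw [h.charPairing_comp, rowPairing_commonCharacterTable, rowPairing_commonCharacterTable] at h1
    by_contra hne
    simp [hne] at h1
  · rintro ⟨χ, hχ⟩
    obtain ⟨i, hi⟩ := exists_row_eq h hrow hχ
    exact ⟨i, Subtype.ext hi⟩
  · intro j
    rw [← h.ncard_eq j]
    congr 1
    ext g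
    exact h.mem_carrier_iff j g
  · intro j g hg
    rw [hord, (h.mem_carrier_iff j g).1 hg]
  · intro i j g hg
    rw [← (h.mem_carrier_iff j g).1 hg]
    rfl

theorem realExceptDegreeThree_of_rows [Fintype G] (h : IsClassLabelling cls)
    (hi : ∀ i, tableEta i = 0 → RowIsReal cls (tableInt i))
    (hrow : ∀ i, IsCharacterOver ℂ (fun g => commonCharacterTable i (cls g))) :
    RealExceptDegreeThree G := by
  have h3 : ∀ i, commonCharacterTable i (cls 1) = 3 → i = 1 ∨ i = 2 := by
    intro i hi3
    rw [h.map_one, commonCharacterTable_apply] at hi3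
    have h0 : ∀ i, tableEta i 0 = 0 := by decide
    rw [h0, Int.cast_zero, zero_mul, add_zero] at hi3
    have : tableInt i 0 = 3 := by exact_mod_cast hi3
    clear hi3
    revert i
    decide
  have h3' : ∀ i, commonCharacterTable i (cls 1) ≠ 3 → tableEta i = 0 := by
    intro i hne
    by_contra hz
    have : ∀ i, tableEta i ≠ 0 → tableInt i 0 = 3 ∧ tableEta i 0 = 0 := by decide
    apply hne
    rw [h.map_one, commonCharacterTable_apply, (this i hz).1, (this i hz).2]
    norm_num
  have hconj : ∀ j, commonCharacterTable 2 j = (starRingEnd ℂ) (commonCharacterTable 1 j) := by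
    intro j
    have he : (starRingEnd ℂ) etaSeven = -1 - etaSeven := etaSevenBar_eq
    have hA : ∀ j, tableInt 2 j = tableInt 1 j - tableEta 1 j := by decide
    have hB : ∀ j, tableEta 2 j = - tableEta 1 j := by decide
    simp only [commonCharacterTable_apply, map_add, map_mul, map_intCast, he, hA, hB]
    push_cast
    ring
  refine ⟨?_, ?_, ?_⟩
  · rintro ⟨χ, hχ⟩ hne
    obtain ⟨i, rfl⟩ := exists_row_eq h hrow hχ
    have hz := h3' i hne
    obtain ⟨V, i1, i2, i3, ρ, hρ⟩ := hi i hz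
    refine ⟨V, i1, i2, i3, ρ, fun g => ?_⟩
    rw [hρ]
    simp [commonCharacterTable_apply, hz]
  · rintro ⟨χ, hχ⟩ heq
    obtain ⟨i, rfl⟩ := exists_row_eq h hrow hχ
    obtain ⟨g, hg⟩ := h.surjective 7
    refine ⟨g, ?_⟩
    simp only [hg]
    rcases h3 i heq with rfl | rfl
    · have : commonCharacterTable 1 7 = etaSeven := rfl
      rw [this]
      exact etaSeven_im_ne_zero
    · rw [hconj, Complex.conj_im, neg_ne_zero]
      exact etaSeven_im_ne_zero
  · rintro ⟨χ, hχ⟩ ⟨ψ, hψ⟩ heq heq' hne g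
    obtain ⟨i, rfl⟩ := exists_row_eq h hrow hχ
    obtain ⟨k, rfl⟩ := exists_row_eq h hrow hψ
    rcases h3 i heq with rfl | rfl <;> rcases h3 k heq' with rfl | rfl
    · exact absurd rfl hne
    · exact hconj _
    · simp only [hconj, Complex.conj_conj]
    · exact absurd rfl hne

/-- All rows are obtained from a few real representations by tensor products and by splitting off
irreducible constituents: `6 ⊗ 6 = 1 + 2·6 + 7₂ + 2·8`, `7₁ ⊗ 6 = 7₁ + 14 + 21₁`,
`7₁ ⊗ 8 = 14 + 21₁ + 21₂`, `7₁ ⊗ 7₂ = 7₃ + 21₁ + 21₂` and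
`7₂ ⊗ 7₂ = 1 + 3₁ + 3₂ + 2·6 + 2·7₂ + 2·8`. -/
theorem table_of_generating_rows [Fintype G] (h : IsClassLabelling cls)
    (h6 : RowIsReal cls (tableInt 3)) (h71 : RowIsReal cls (tableInt 4))
    (h8 : RowIsReal cls (tableInt 7))
    (h14 : RowIsReal cls (tableInt 8) ∨ RowIsReal cls (tableInt 9))
    {ord : Fin 11 → ℕ} (hord : ∀ g, orderOf g = ord (cls g)) :
    HasCharacterTable G commonCharacterTable commonClassSizes ord ∧ RealExceptDegreeThree G := by
  have h1 : RowIsReal cls (tableInt 0) := rowIsReal_zero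
  have h72 : RowIsReal cls (tableInt 5) := by
    have := (((((h6.mul h6).sub h h1 (by decide) (by decide)).sub h h6 (by decide) (by decide)).sub
      h h6 (by decide) (by decide)).sub h h8 (by decide) (by decide)).sub h h8 (by decide)
      (by decide)
    convert this using 1
    decide
  have h35 := (h71.mul h6).sub h h71 (by decide) (by decide)
  obtain ⟨h14, h211⟩ : RowIsReal cls (tableInt 8) ∧ RowIsReal cls (tableInt 9) := by
    rcases h14 with h14 | h211
    · refine ⟨h14, ?_⟩
      convert h35.sub h h14 (by decide) (by decide) using 1
      decide
    · refine ⟨?_, h211⟩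
      convert h35.sub h h211 (by decide) (by decide) using 1
      decide
  have h212 : RowIsReal cls (tableInt 10) := by
    convert ((h71.mul h8).sub h h14 (by decide) (by decide)).sub h h211 (by decide) (by decide)
      using 1
    decide
  have h73 : RowIsReal cls (tableInt 6) := by
    convert ((h71.mul h72).sub h h211 (by decide) (by decide)).sub h h212 (by decide) (by decide)
      using 1
    decide
  have h33 : RowIsReal cls ![6, 6, -2, 0, -2, -2, 0, -1, -1, 2, 2] := by
    convert (((((((h72.mul h72).sub h h1 (by decide) (by decide)).sub h h6 (by decide)
      (by decide)).sub h h6 (by decide) (by decide)).sub h h72 (by decide) (by decide)).sub h h72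
      (by decide) (by decide)).sub h h8 (by decide) (by decide)).sub h h8 (by decide) (by decide)
      using 1
    decide
  have hi : ∀ i, tableEta i = 0 → RowIsReal cls (tableInt i) := by
    have h12 : tableEta 1 ≠ 0 ∧ tableEta 2 ≠ 0 := by decide
    intro i hz
    fin_cases i
    exacts [h1, absurd hz h12.1, absurd hz h12.2, h6, h71, h72, h73, h8, h14, h211, h212]
  have hrow := isCharacterOver_row h hi h33
  exact ⟨hasCharacterTable_of_rows h hrow hord, realExceptDegreeThree_of_rows h hi hrow⟩

end ClassFunctions

/-! ### Codes of signed permutations of eight points -/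

section Codes

/-- The `i`-th hexadecimal digit of `p`. -/
def digit (p i : ℕ) : ℕ := p / 16 ^ i % 16

/-- The number with hexadecimal digits `d 0, …, d 7`. -/
def pack (d : ℕ → ℕ) : ℕ :=
  d 0 + 16 * (d 1 + 16 * (d 2 + 16 * (d 3 + 16 * (d 4 + 16 * (d 5 + 16 * (d 6 + 16 * d 7))))))

/-- The signed points are the numbers `d < 16`: the point `d % 8`, with a minus sign if `8 ≤ d`.
A number `p` encodes the map of signed points that commutes with the change of sign and sends the
point `i < 8` to the signed point `digit p i`. -/
def signedApply (p d : ℕ) : ℕ := (digit p (d % 8) + d / 8 * 8) % 16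

/-- The code of the composite of the maps encoded by `p` and `q`. -/
def codeComp (p q : ℕ) : ℕ := pack fun i => signedApply p (digit q i)

/-- The code of the identity. -/
def codeOne : ℕ := pack id

/-- The code of the `n`-th power of the map encoded by `p`. -/
def codePow (p : ℕ) : ℕ → ℕ
  | 0 => codeOne
  | n + 1 => codeComp (codePow p n) p

/-- Whether the maps encoded by `h`, `p`, `q` satisfy `h ∘ p = q ∘ h`. The points `1`, `2`, `4`
come first because they determine an element of either group, up to the image of `0`: a failure
is found early. -/
def intertwines (h p q : ℕ) : Bool :=
  [1, 2, 4, 0, 3, 5, 6, 7].all fun i =>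
    Nat.beq (signedApply h (digit p i)) (signedApply q (digit h i))

theorem digit_lt (p i : ℕ) : digit p i < 16 := Nat.mod_lt _ (by norm_num)

theorem signedApply_lt (p d : ℕ) : signedApply p d < 16 := Nat.mod_lt _ (by norm_num)

theorem digit_pack {d : ℕ → ℕ} (hd : ∀ i, d i < 16) {i : ℕ} (hi : i < 8) :
    digit (pack d) i = d i := by
  have h0 := hd 0
  have h1 := hd 1
  have h2 := hd 2
  have h3 := hd 3
  have h4 := hd 4
  have h5 := hd 5
  have h6 := hd 6
  have h7 := hd 7
  simp only [digit, pack]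
  interval_cases i <;> omega

theorem pack_congr {d d' : ℕ → ℕ} (h : ∀ i < 8, d i = d' i) : pack d = pack d' := by
  simp [pack, h]

theorem digit_codeComp (p q : ℕ) {i : ℕ} (hi : i < 8) :
    digit (codeComp p q) i = signedApply p (digit q i) :=
  digit_pack (fun _ => signedApply_lt _ _) hi

theorem intertwines_iff (h p q : ℕ) : intertwines h p q ↔ codeComp h p = codeComp q h := by
  have e : intertwines h p q ↔
      ∀ i < 8, signedApply h (digit p i) = signedApply q (digit h i) := by
    simp only [intertwines, List.all_eq_true, Nat.beq_eq]
    refine ⟨fun H i hi => H i ?_, fun H i hi => H i ?_⟩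
    · interval_cases i <;> simp
    · fin_cases hi <;> simp
  rw [e]
  refine ⟨fun H => pack_congr H, fun H i hi => ?_⟩
  rw [← digit_codeComp h p hi, H, digit_codeComp q h hi]

/-- `code` is a faithful encoding of the group `G` by maps of signed points, with image `L`. -/
structure IsCoding {G : Type} [Group G] (code : G → ℕ) (L : List ℕ) : Prop where
  injective : Function.Injective code
  map_one : code 1 = codeOne
  map_mul : ∀ g h, code (g * h) = codeComp (code g) (code h)
  mem_iff : ∀ p, p ∈ L ↔ ∃ g, code g = p

/-- The codes `r j` represent the classes of a group with codes `L`: their centralizers have the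
index prescribed by the table, two of them with the same index are not conjugate, `r j` has order
`ord j` and is conjugate to the inverse of `r (invClass j)`. -/
structure IsClassSystem (L : List ℕ) (r : Fin 11 → ℕ) (ord : Fin 11 → ℕ) : Prop where
  nodup : L.Nodup
  length : L.length = 1344
  mem : ∀ j, r j ∈ L
  countP_self : ∀ j, commonClassSizes j * L.countP (intertwines · (r j) (r j)) = 1344
  all_not : ∀ i j, i < j → commonClassSizes i = commonClassSizes j →
    L.all fun h => !intertwines h (r i) (r j)
  zero : r 0 = codeOne
  any_inv : ∀ j, L.any fun h => codeComp (codeComp (r j) h) (r (invClass j)) == h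
  ord_pos : ∀ j, 0 < ord j
  pow_ord : ∀ j, codePow (r j) (ord j) = codeOne
  pow_ne : ∀ j, ∀ m < ord j, m ≠ 0 → codePow (r j) m ≠ codeOne

namespace IsCoding

variable {G : Type} [Group G] {code : G → ℕ} {L : List ℕ}

theorem mem (hc : IsCoding code L) (g : G) : code g ∈ L := (hc.mem_iff _).2 ⟨g, rfl⟩

theorem map_pow (hc : IsCoding code L) (g : G) (n : ℕ) : code (g ^ n) = codePow (code g) n := by
  induction n with
  | zero => rw [pow_zero, hc.map_one, codePow]
  | succ n ih => rw [pow_succ, hc.map_mul, ih, codePow]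

theorem intertwines_iff (hc : IsCoding code L) (h p q : G) :
    intertwines (code h) (code p) (code q) ↔ h * p = q * h := by
  rw [_root_.intertwines_iff, ← hc.map_mul, ← hc.map_mul, hc.injective.eq_iff]

theorem finite (hc : IsCoding code L) : Finite G := by
  classical
  exact Finite.of_injective (fun g => (⟨code g, List.mem_toFinset.2 (hc.mem g)⟩ : L.toFinset))
    fun g h e => hc.injective (congrArg Subtype.val e)

theorem ncard_eq (hc : IsCoding code L) (hL : L.Nodup) (P : ℕ → Bool) :
    {g | P (code g)}.ncard = L.countP P := by
  classical
  rw [← Set.ncard_image_of_injective _ hc.injective, List.countP_eq_length_filter,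
    ← List.toFinset_card_of_nodup (hL.filter _), ← Set.ncard_coe_finset]
  congr 1
  ext p
  simp only [Set.mem_image, Set.mem_ofPred_eq, List.coe_toFinset, List.mem_filter, hc.mem_iff]
  constructor
  · rintro ⟨g, hg, rfl⟩
    exact ⟨⟨g, rfl⟩, hg⟩
  · rintro ⟨⟨g, rfl⟩, hg⟩
    exact ⟨g, hg, rfl⟩

theorem card_eq (hc : IsCoding code L) (hL : L.Nodup) : Nat.card G = L.length := by
  have := hc.ncard_eq hL fun _ => true
  simpa [Set.ncard_univ] using this

variable {r : Fin 11 → ℕ} {ord : Fin 11 → ℕ}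

theorem ncard_conj [Finite G] (hc : IsCoding code L) (hs : IsClassSystem L r ord) {j : Fin 11}
    {g : G} (hg : code g = r j) : {h | IsConj g h}.ncard = commonClassSizes j := by
  have h1 : Nat.card (MulAction.orbit (ConjAct G) g) *
      Nat.card (MulAction.stabilizer (ConjAct G) g) = 1344 := by
    rw [← hs.length, ← hc.card_eq hs.nodup]
    cases nonempty_fintype G
    classical
    have := Fintype.ofFinite (MulAction.orbit (ConjAct G) g)
    have := Fintype.ofFinite (MulAction.stabilizer (ConjAct G) g)
    have := Fintype.ofFinite (ConjAct G)
    rw [Nat.card_eq_fintype_card, Nat.card_eq_fintype_card,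
      MulAction.card_orbit_mul_card_stabilizer_eq_card_group, ← Nat.card_eq_fintype_card]
    exact Nat.card_congr ConjAct.ofConjAct.toEquiv
  rw [← Subgroup.nat_card_centralizer_nat_card_stabilizer] at h1
  have h2 : Nat.card (Subgroup.centralizer {g}) = L.countP (intertwines · (r j) (r j)) := by
    rw [← hc.ncard_eq hs.nodup]
    change Nat.card ((Subgroup.centralizer {g} : Subgroup G) : Set G) = _
    rw [Nat.card_coe_set_eq]
    congr 1
    ext h
    rw [Set.mem_ofPred_eq, ← hg, hc.intertwines_iff, SetLike.mem_coe,
      Subgroup.mem_centralizer_singleton_iff]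
  have h3 : MulAction.orbit (ConjAct G) g = {h | IsConj g h} := by
    ext h
    rw [ConjAct.mem_orbit_conjAct, Set.mem_ofPred_eq, isConj_comm]
  rw [h2, h3, Nat.card_coe_set_eq] at h1
  have h4 := hs.countP_self j
  have h5 : 0 < L.countP (intertwines · (r j) (r j)) := Nat.pos_of_ne_zero fun h0 => by
    rw [h0] at h4; omega
  exact Nat.eq_of_mul_eq_mul_right h5 (h1.trans h4.symm)

theorem exists_code (hc : IsCoding code L) (hs : IsClassSystem L r ord) (j : Fin 11) :
    ∃ g, code g = r j := (hc.mem_iff _).1 (hs.mem j)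

/-- A representative of the `j`-th class. -/
noncomputable def rep (hc : IsCoding code L) (hs : IsClassSystem L r ord) (j : Fin 11) : G :=
  (hc.exists_code hs j).choose

theorem code_rep (hc : IsCoding code L) (hs : IsClassSystem L r ord) (j : Fin 11) :
    code (hc.rep hs j) = r j := (hc.exists_code hs j).choose_spec

theorem eq_of_isConj_rep [Finite G] (hc : IsCoding code L) (hs : IsClassSystem L r ord)
    {i j : Fin 11} (hij : IsConj (hc.rep hs i) (hc.rep hs j)) : i = j := by
  have key : ∀ i j, i < j → ¬ IsConj (hc.rep hs i) (hc.rep hs j) := by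
    intro i j hlt hcon
    have hsize : commonClassSizes i = commonClassSizes j := by
      rw [← hc.ncard_conj hs (hc.code_rep hs i), ← hc.ncard_conj hs (hc.code_rep hs j)]
      congr 1
      ext g
      exact ⟨hcon.symm.trans, hcon.trans⟩
    obtain ⟨c, hcc⟩ := isConj_iff.1 hcon
    have h1 : intertwines (code c) (r i) (r j) := by
      rw [← hc.code_rep hs i, ← hc.code_rep hs j, hc.intertwines_iff, ← hcc]
      group
    have h2 := List.all_eq_true.1 (hs.all_not i j hlt hsize) _ (hc.mem c)
    rw [h1] at h2
    exact Bool.false_ne_true h2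
  rcases lt_trichotomy i j with h | h | h
  exacts [absurd hij (key i j h), h, absurd hij.symm (key j i h)]

/-- The classes of the representatives exhaust the group, because their sizes add up. -/
theorem exists_isConj_rep (hc : IsCoding code L) (hs : IsClassSystem L r ord) (g : G) :
    ∃ j, IsConj (hc.rep hs j) g := by
  classical
  have := hc.finite
  cases nonempty_fintype G
  let s : Fin 11 → Finset G := fun j => {g | IsConj (hc.rep hs j) g}
  have hdis : Set.PairwiseDisjoint (Finset.univ : Finset (Fin 11)) s := by
    intro i _ j _ hne
    rw [Function.onFun, Finset.disjoint_left]
    intro g hi hj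
    simp only [s, Finset.mem_filter, Finset.mem_univ, true_and] at hi hj
    exact hne (hc.eq_of_isConj_rep hs (hi.trans hj.symm))
  have hcard : ∀ j, (s j).card = commonClassSizes j := fun j => by
    rw [← hc.ncard_conj hs (hc.code_rep hs j), ← Set.ncard_coe_finset]
    congr 1
    ext h
    simp [s]
  have huniv : Finset.univ.biUnion s = Finset.univ := by
    apply Finset.eq_univ_of_card
    rw [Finset.card_biUnion hdis, ← Nat.card_eq_fintype_card, hc.card_eq hs.nodup, hs.length]
    simp only [hcard]
    decide
  have hg := Finset.mem_univ g
  rw [← huniv, Finset.mem_biUnion] at hg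
  obtain ⟨j, -, hj⟩ := hg
  exact ⟨j, by simpa [s] using hj⟩

/-- The label of the class of `g`. -/
noncomputable def cls (hc : IsCoding code L) (hs : IsClassSystem L r ord) (g : G) : Fin 11 :=
  (hc.exists_isConj_rep hs g).choose

theorem isConj_rep_cls (hc : IsCoding code L) (hs : IsClassSystem L r ord) (g : G) :
    IsConj (hc.rep hs (hc.cls hs g)) g := (hc.exists_isConj_rep hs g).choose_spec

theorem cls_eq_iff (hc : IsCoding code L) (hs : IsClassSystem L r ord) (g : G) (j : Fin 11) :
    hc.cls hs g = j ↔ IsConj (hc.rep hs j) g := by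
  have := hc.finite
  constructor
  · rintro rfl
    exact hc.isConj_rep_cls hs g
  · intro h
    exact hc.eq_of_isConj_rep hs ((hc.isConj_rep_cls hs g).trans h.symm)

theorem isClassLabelling (hc : IsCoding code L) (hs : IsClassSystem L r ord) :
    IsClassLabelling (hc.cls hs) where
  isConj_iff g h := by
    constructor
    · intro hgh
      exact ((hc.cls_eq_iff hs h _).2 ((hc.isConj_rep_cls hs g).trans hgh)).symm
    · intro e
      exact ((hc.cls_eq_iff hs g _).1 e).symm.trans (hc.isConj_rep_cls hs h)
  ncard_eq j := by
    have := hc.finite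
    simp only [hc.cls_eq_iff hs]
    exact hc.ncard_conj hs (hc.code_rep hs j)
  map_one := by
    rw [hc.cls_eq_iff hs]
    have : hc.rep hs 0 = 1 := hc.injective (by rw [hc.code_rep, hs.zero, hc.map_one])
    rw [this]
  map_inv g := by
    rw [hc.cls_eq_iff hs]
    obtain ⟨p, hp, hpe⟩ := List.any_eq_true.1 (hs.any_inv (hc.cls hs g))
    obtain ⟨h, rfl⟩ := (hc.mem_iff p).1 hp
    rw [beq_iff_eq, ← hc.code_rep hs, ← hc.code_rep hs, ← hc.map_mul, ← hc.map_mul,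
      hc.injective.eq_iff] at hpe
    have h1 : IsConj (hc.rep hs (invClass (hc.cls hs g))) (hc.rep hs (hc.cls hs g))⁻¹ := by
      refine isConj_iff.2 ⟨h, ?_⟩
      rw [mul_inv_eq_iff_eq_mul, eq_inv_mul_iff_mul_eq, ← mul_assoc]
      exact hpe
    obtain ⟨c, hcc⟩ := isConj_iff.1 (hc.isConj_rep_cls hs g)
    refine h1.trans (isConj_iff.2 ⟨c, ?_⟩)
    rw [← conj_inv, hcc]

theorem orderOf_eq (hc : IsCoding code L) (hs : IsClassSystem L r ord) (g : G) :
    orderOf g = ord (hc.cls hs g) := by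
  obtain ⟨c, hcc⟩ := isConj_iff.1 (hc.isConj_rep_cls hs g)
  have h1 : orderOf g = orderOf (hc.rep hs (hc.cls hs g)) := by
    conv_lhs => rw [← hcc]
    exact MulEquiv.orderOf_eq (MulAut.conj c) _
  rw [h1, orderOf_eq_iff (hs.ord_pos _)]
  constructor
  · apply hc.injective
    rw [hc.map_pow, hc.code_rep, hs.pow_ord, hc.map_one]
  · intro m hm h0 he
    apply hs.pow_ne _ m hm h0.ne'
    rw [← hc.code_rep hs, ← hc.map_pow, he, hc.map_one]

end IsCoding

end Codes

/-! ### Signed permutation representations -/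

section SignedPermutation

variable {G : Type} [Group G]

/-- The character of the representation on `X → ℝ` given by an action on `X` and a cocycle of
integral scalars. -/
theorem isCharacterOver_of_cocycle {X : Type} [Fintype X] [DecidableEq X] (π : G → X → X)
    (s : G → X → ℤ) (hπ1 : ∀ x, π 1 x = x) (hs1 : ∀ x, s 1 x = 1)
    (hπ : ∀ g h x, π (g * h) x = π g (π h x))
    (hs : ∀ g h x, s (g * h) x = s g (π h x) * s h x) :
    IsCharacterOver ℝ (fun g => ((∑ x, if π g x = x then s g x else 0 : ℤ) : ℝ)) := by
  let M : G →* Matrix X X ℝ :=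
    { toFun := fun g => .of fun y x => if π g x = y then (s g x : ℝ) else 0
      map_one' := by
        ext y x
        simp [hπ1, hs1, Matrix.one_apply, eq_comm]
      map_mul' := fun g h => by
        ext z x
        rw [Matrix.mul_apply, Finset.sum_eq_single (π h x)]
        · simp [hπ, hs]
        · intro y _ hy
          simp [hy.symm]
        · simp }
  refine ⟨X → ℝ, _, _, inferInstance,
    (Matrix.toLinAlgEquiv' : Matrix X X ℝ ≃ₐ[ℝ] _).toAlgHom.toMonoidHom.comp M, ?_⟩
  ext g
  change LinearMap.trace ℝ _ (Matrix.toLin' (M g)) = _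
  rw [Matrix.trace_toLin'_eq, Matrix.trace]
  simp [M]

/-- The point to which the map with code `p` sends `i`, up to sign. -/
def codeIndex (p : ℕ) (i : Fin 8) : Fin 8 := ⟨digit p i % 8, Nat.mod_lt _ (by norm_num)⟩

/-- The sign with which the map with code `p` sends `i` to another point. -/
def codeSign (p : ℕ) (i : Fin 8) : ℤ := if digit p i < 8 then 1 else -1

/-- The trace of the signed permutation with code `p`. -/
def codeTrace (p : ℕ) : ℤ := ∑ i, if codeIndex p i = i then codeSign p i else 0

/-- The sign of the action on unordered pairs (that is, on the symmetric square). -/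
def codeSignSym (p : ℕ) : Sym2 (Fin 8) → ℤ :=
  Sym2.lift ⟨fun i j => codeSign p i * codeSign p j, fun _ _ => mul_comm _ _⟩

/-- The trace of the signed permutation with code `p` on the symmetric square. -/
def codeTraceSym (p : ℕ) : ℤ :=
  ∑ x, if Sym2.map (codeIndex p) x = x then codeSignSym p x else 0

theorem codeIndex_codeComp (p q : ℕ) (i : Fin 8) :
    codeIndex (codeComp p q) i = codeIndex p (codeIndex q i) := by
  apply Fin.ext
  simp only [codeIndex, digit_codeComp p q i.2, signedApply]
  omega

theorem codeSign_codeComp (p q : ℕ) (i : Fin 8) :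
    codeSign (codeComp p q) i = codeSign p (codeIndex q i) * codeSign q i := by
  simp only [codeIndex, codeSign, digit_codeComp p q i.2, signedApply]
  have key : ∀ a < 16, ∀ b < 16, (if (a + b / 8 * 8) % 16 < 8 then (1 : ℤ) else -1) =
      (if a < 8 then 1 else -1) * (if b < 8 then 1 else -1) := by decide
  exact key _ (digit_lt p _) _ (digit_lt q _)

theorem codeIndex_codeOne (i : Fin 8) : codeIndex codeOne i = i := by
  revert i; decide

theorem codeSign_codeOne (i : Fin 8) : codeSign codeOne i = 1 := by
  revert i; decide

theorem isCharacterOver_codeTrace {c : G → ℕ} (h1 : c 1 = codeOne)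
    (hmul : ∀ g h, c (g * h) = codeComp (c g) (c h)) :
    IsCharacterOver ℝ (fun g => (codeTrace (c g) : ℝ)) :=
  isCharacterOver_of_cocycle (fun g => codeIndex (c g)) (fun g => codeSign (c g))
    (fun x => by rw [h1, codeIndex_codeOne]) (fun x => by rw [h1, codeSign_codeOne])
    (fun g h x => by rw [hmul, codeIndex_codeComp])
    (fun g h x => by rw [hmul, codeSign_codeComp])

theorem isCharacterOver_codeTraceSym {c : G → ℕ} (h1 : c 1 = codeOne)
    (hmul : ∀ g h, c (g * h) = codeComp (c g) (c h)) :
    IsCharacterOver ℝ (fun g => (codeTraceSym (c g) : ℝ)) := by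
  refine isCharacterOver_of_cocycle (fun g => Sym2.map (codeIndex (c g)))
    (fun g => codeSignSym (c g)) ?_ ?_ ?_ ?_
  · intro x
    induction x with
    | _ i j => simp [h1, codeIndex_codeOne]
  · intro x
    induction x with
    | _ i j => simp [h1, codeSignSym, codeSign_codeOne]
  · intro g h x
    induction x with
    | _ i j => simp [hmul, codeIndex_codeComp]
  · intro g h x
    induction x with
    | _ i j =>
      simp only [hmul, codeSignSym, Sym2.lift_mk, Sym2.map_mk, codeSign_codeComp]
      ring

namespace IsCoding

variable {code : G → ℕ} {L : List ℕ} {r : Fin 11 → ℕ} {ord : Fin 11 → ℕ}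

theorem rowIsReal (hc : IsCoding code L) (hs : IsClassSystem L r ord) {t : G → ℤ}
    (ht : IsCharacterOver ℝ (fun g => (t g : ℝ))) {row : Fin 11 → ℤ}
    (hrow : ∀ j, t (hc.rep hs j) = row j) : RowIsReal (hc.cls hs) row := by
  have e : (fun g => (row (hc.cls hs g) : ℝ)) = fun g => (t g : ℝ) := by
    ext g
    rw [← hrow]
    exact ht.conj_eq (hc.isConj_rep_cls hs g)
  rw [RowIsReal, e]
  exact ht

/-- The character table of a coded group. The eight points afford `1 + 7₁`; a second action `lin`
on eight points, with trivial signs, affords `2·1 + 6`, and its symmetric square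
`4·1 + 4·6 + 8`. The symmetric square of the first action yields `21₁` or `14`. -/
theorem table (hc : IsCoding code L) (hs : IsClassSystem L r ord) {lin : G → ℕ}
    (hl1 : lin 1 = codeOne) (hlmul : ∀ g h, lin (g * h) = codeComp (lin g) (lin h))
    {l : Fin 11 → ℕ} (hl : ∀ j, lin (hc.rep hs j) = l j)
    (t1 : ∀ j, codeTrace (r j) = tableInt 0 j + tableInt 4 j)
    (t2 : ∀ j, codeTrace (l j) = 2 * tableInt 0 j + tableInt 3 j)
    (t3 : ∀ j, codeTraceSym (l j) = 4 * tableInt 0 j + 4 * tableInt 3 j + tableInt 7 j)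
    (t4 : (∀ j, codeTraceSym (r j) =
        2 * tableInt 0 j + tableInt 3 j + tableInt 4 j + tableInt 9 j) ∨
      ∀ j, codeTraceSym (r j) =
        2 * tableInt 0 j + tableInt 3 j + 2 * tableInt 4 j + tableInt 8 j) :
    HasCharacterTable G commonCharacterTable commonClassSizes ord ∧ RealExceptDegreeThree G := by
  have := hc.finite
  cases nonempty_fintype G
  have h := hc.isClassLabelling hs
  have h1 : RowIsReal (hc.cls hs) (tableInt 0) := rowIsReal_zero
  have h71 : RowIsReal (hc.cls hs) (tableInt 4) := by
    have := hc.rowIsReal hs (isCharacterOver_codeTrace hc.map_one hc.map_mul)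
      (row := tableInt 0 + tableInt 4) fun j => by rw [hc.code_rep hs, t1]; rfl
    convert this.sub h h1 (by decide) (by decide) using 1
    decide
  have h6 : RowIsReal (hc.cls hs) (tableInt 3) := by
    have := hc.rowIsReal hs (isCharacterOver_codeTrace hl1 hlmul)
      (row := 2 * tableInt 0 + tableInt 3) fun j => by rw [hl, t2]; rfl
    convert (this.sub h h1 (by decide) (by decide)).sub h h1 (by decide) (by decide) using 1
    decide
  have h8 : RowIsReal (hc.cls hs) (tableInt 7) := by
    have := hc.rowIsReal hs (isCharacterOver_codeTraceSym hl1 hlmul)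
      (row := 4 * tableInt 0 + 4 * tableInt 3 + tableInt 7) fun j => by rw [hl, t3]; rfl
    have := (((this.sub h h1 (by decide) (by decide)).sub h h1 (by decide) (by decide)).sub h h1
      (by decide) (by decide)).sub h h1 (by decide) (by decide)
    convert (((this.sub h h6 (by decide) (by decide)).sub h h6 (by decide) (by decide)).sub h h6
      (by decide) (by decide)).sub h h6 (by decide) (by decide) using 1
    decide
  have hsym := isCharacterOver_codeTraceSym hc.map_one hc.map_mul
  refine table_of_generating_rows h h6 h71 h8 ?_ (hc.orderOf_eq hs)
  rcases t4 with t4 | t4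
  · right
    have := hc.rowIsReal hs hsym
      (row := 2 * tableInt 0 + tableInt 3 + tableInt 4 + tableInt 9) fun j => by
        rw [hc.code_rep hs, t4]; rfl
    convert (((this.sub h h1 (by decide) (by decide)).sub h h1 (by decide) (by decide)).sub h h6
      (by decide) (by decide)).sub h h71 (by decide) (by decide) using 1
    decide
  · left
    have := hc.rowIsReal hs hsym
      (row := 2 * tableInt 0 + tableInt 3 + 2 * tableInt 4 + tableInt 8) fun j => by
        rw [hc.code_rep hs, t4]; rfl
    convert ((((this.sub h h1 (by decide) (by decide)).sub h h1 (by decide) (by decide)).sub h h6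
      (by decide) (by decide)).sub h h71 (by decide) (by decide)).sub h h71 (by decide)
      (by decide) using 1
    decide

end IsCoding

end SignedPermutation

/-! ### The codes of the two groups -/

section GroupCodes

/-- The linear part of a code: the images of the points, up to sign and translation by the image
of `0`. -/
def codeLin (p : ℕ) : ℕ := pack fun i => (digit p i % 8) ^^^ (digit p 0 % 8)

/-- A number that determines the images of `0`, `1`, `2` and `4`, and increases along the lists of
codes below. -/
def codeKey (p : ℕ) : ℕ :=
  (digit p 4 ^^^ digit p 0) + 16 * ((digit p 2 ^^^ digit p 0) +
    16 * ((digit p 1 ^^^ digit p 0) + 16 * digit p 0))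

/-- The affine map `x ↦ v + x₀ a + x₁ b + x₂ c` of the space `𝔽₂³` of three-bit numbers. -/
def affineCode (v a b c : ℕ) : ℕ :=
  pack fun i => v ^^^ (if i % 2 = 1 then a else 0) ^^^ (if i / 2 % 2 = 1 then b else 0) ^^^
    (if i / 4 % 2 = 1 then c else 0)

/-- The codes of the elements of the affine group of `𝔽₂³`. -/
def affineCodes : List ℕ :=
  (List.range 8).flatMap fun v => (List.range 8).flatMap fun a =>
    if a = 0 then [] else (List.range 8).flatMap fun b =>
      if b = 0 ∨ b = a then [] else (List.range 8).flatMap fun c =>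
        if c = 0 ∨ c = a ∨ c = b ∨ c = a ^^^ b then [] else [affineCode v a b c]

/-- The product of signed units. The point `i` stands for `e_i`, except that `5` and `7` are
interchanged: with this labelling, `e_i e_j = ± e_k` for the bitwise sum `k` of `i` and `j`. The
sign is bit number `8 i + j` of the constant. -/
def signedUnitMul (a b : ℕ) : ℕ :=
  ((a % 8) ^^^ (b % 8)) +
    8 * ((a / 8 + b / 8 + 14725346459690379776 / 2 ^ (8 * (a % 8) + b % 8)) % 2)

/-- The code of the automorphism that maps the points `1`, `2`, `4` to the signed points `a`, `b`,
`c`. The other points are `e₁e₂`, `e₁e₄`, `e₂e₄` and `-(e₁e₂)e₄` in terms of these. -/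
def automorphismCode (a b c : ℕ) : ℕ :=
  pack fun i => match i with
    | 0 => 0
    | 1 => a
    | 2 => b
    | 3 => signedUnitMul a b
    | 4 => c
    | 5 => signedUnitMul a c
    | 6 => signedUnitMul b c
    | _ => (signedUnitMul (signedUnitMul a b) c + 8) % 16

/-- The codes of the automorphisms of the set of signed units. -/
def automorphismCodes : List ℕ :=
  (List.range 16).flatMap fun a =>
    if a % 8 = 0 then [] else (List.range 16).flatMap fun b =>
      if b % 8 = 0 ∨ b % 8 = a % 8 then [] else (List.range 16).flatMap fun c =>
        if c % 8 = 0 ∨ c % 8 = a % 8 ∨ c % 8 = b % 8 ∨ c % 8 = (a % 8) ^^^ (b % 8) then [] else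
          [automorphismCode a b c]

/-- Codes of representatives of the classes of the affine group, in the order of the table. -/
def affineReps : Fin 11 → ℕ :=
  ![1985229328, 19088743, 19092598, 22308658, 20075623, 22295143, 21325603, 38154613, 38164243,
    21312118, 20080468]

/-- Codes of representatives of the classes of the group of automorphisms, in the order of the
table. -/
def automorphismReps : Fin 11 → ℕ :=
  ![1985229328, 1994177040, 506747504, 308214960, 373086960, 374488304, 316044464, 307193264,
    308660144, 309616304, 318559920]

/-- Distinctness of the codes is checked through a strictly increasing key, which takes linear
time. -/
theorem nodup_of_isChain_codeKey {L : List ℕ} (h : (L.map codeKey).IsChain (· < ·)) : L.Nodup := by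
  rw [List.isChain_iff_pairwise] at h
  exact List.Nodup.of_map _ (h.imp fun h => h.ne)

theorem isClassSystem_affineCodes : IsClassSystem affineCodes affineReps splitClassOrders where
  nodup := nodup_of_isChain_codeKey (by decide +kernel)
  length := by decide +kernel
  mem := by decide +kernel
  countP_self := by decide +kernel
  all_not := by decide +kernel
  zero := by decide +kernel
  any_inv := by decide +kernel
  ord_pos := by decide
  pow_ord := by decide +kernel
  pow_ne := by decide +kernel

theorem isClassSystem_automorphismCodes :
    IsClassSystem automorphismCodes automorphismReps nonSplitClassOrders where
  nodup := nodup_of_isChain_codeKey (by decide +kernel)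
  length := by decide +kernel
  mem := by decide +kernel
  countP_self := by decide +kernel
  all_not := by decide +kernel
  zero := by decide +kernel
  any_inv := by decide +kernel
  ord_pos := by decide
  pow_ord := by decide +kernel
  pow_ne := by decide +kernel

/-- The maps in the list are multiplicative on products of points. -/
theorem automorphismCodes_map_mul : automorphismCodes.all fun p =>
    (List.range 8).all fun i => (List.range 8).all fun j =>
      Nat.beq (signedUnitMul (digit p i) (digit p j)) (signedApply p (signedUnitMul i j)) := by
  decide +kernel

/-- The maps in the list fix the point `0` and permute the points up to sign. -/
theorem automorphismCodes_bijective : automorphismCodes.all fun p =>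
    p == pack (digit p) && digit p 0 == 0 &&
      (List.range 8).all fun i => (i == 0 || digit p i % 8 != 0) &&
        (List.range 8).any fun j => digit p j % 8 == i := by
  decide +kernel

theorem codeTrace_affineReps (j : Fin 11) :
    codeTrace (affineReps j) = tableInt 0 j + tableInt 4 j := by
  revert j; decide +kernel

theorem codeTrace_codeLin_affineReps (j : Fin 11) :
    codeTrace (codeLin (affineReps j)) = 2 * tableInt 0 j + tableInt 3 j := by
  revert j; decide +kernel

theorem codeTraceSym_codeLin_affineReps (j : Fin 11) : codeTraceSym (codeLin (affineReps j)) =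
    4 * tableInt 0 j + 4 * tableInt 3 j + tableInt 7 j := by
  revert j; decide +kernel

theorem codeTraceSym_affineReps (j : Fin 11) : codeTraceSym (affineReps j) =
    2 * tableInt 0 j + tableInt 3 j + 2 * tableInt 4 j + tableInt 8 j := by
  revert j; decide +kernel

theorem codeTrace_automorphismReps (j : Fin 11) :
    codeTrace (automorphismReps j) = tableInt 0 j + tableInt 4 j := by
  revert j; decide +kernel

theorem codeTrace_codeLin_automorphismReps (j : Fin 11) :
    codeTrace (codeLin (automorphismReps j)) = 2 * tableInt 0 j + tableInt 3 j := by
  revert j; decide +kernel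

theorem codeTraceSym_codeLin_automorphismReps (j : Fin 11) :
    codeTraceSym (codeLin (automorphismReps j)) =
      4 * tableInt 0 j + 4 * tableInt 3 j + tableInt 7 j := by
  revert j; decide +kernel

theorem codeTraceSym_automorphismReps (j : Fin 11) : codeTraceSym (automorphismReps j) =
    2 * tableInt 0 j + tableInt 3 j + tableInt 4 j + tableInt 9 j := by
  revert j; decide +kernel

end GroupCodes

/-! ### Coding the automorphisms of the octonionic set -/

section OctonionCoding

/-- The index of the imaginary unit at a point: `5` and `7` are interchanged. -/
def unitIndex (i : ℕ) : Fin 8 := ![0, 1, 2, 3, 4, 7, 6, 5] (Fin.ofNat 8 i)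

/-- The octonion at the signed point `d`. -/
noncomputable def signedUnit (d : ℕ) : Octonion :=
  (-1 : ℝ) ^ (d / 8) • Pi.single (unitIndex d) 1

theorem unitIndex_eq_iff {i j : ℕ} : unitIndex i = unitIndex j ↔ i % 8 = j % 8 := by
  have h : ∀ a b : Fin 8, (![0, 1, 2, 3, 4, 7, 6, 5] a : Fin 8) = ![0, 1, 2, 3, 4, 7, 6, 5] b ↔
      a.1 = b.1 := by decide
  exact h _ _

theorem unitIndex_mod (d : ℕ) : unitIndex (d % 8) = unitIndex d :=
  unitIndex_eq_iff.2 (Nat.mod_mod d 8)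

theorem unitIndex_zero : unitIndex 0 = 0 := rfl

theorem exists_unitIndex_eq (k : Fin 8) : ∃ i < 8, unitIndex i = k := by
  revert k; decide

theorem signedUnit_of_lt {i : ℕ} (hi : i < 8) : signedUnit i = Pi.single (unitIndex i) 1 := by
  rw [signedUnit, Nat.div_eq_of_lt hi, pow_zero, one_smul]

theorem signedUnit_eq (d : ℕ) : signedUnit d = (-1 : ℝ) ^ (d / 8) • signedUnit (d % 8) := by
  rw [signedUnit_of_lt (Nat.mod_lt _ (by norm_num)), unitIndex_mod, signedUnit]

theorem signedUnit_mod (d : ℕ) : signedUnit (d % 16) = signedUnit d := by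
  rw [signedUnit_eq, signedUnit_eq d, show d % 16 % 8 = d % 8 by omega]
  congr 1
  rw [neg_one_pow_eq_pow_mod_two, neg_one_pow_eq_pow_mod_two (d / 8)]
  congr 1
  omega

theorem signedUnit_add_eight (d k : ℕ) :
    signedUnit (d + k * 8) = (-1 : ℝ) ^ k • signedUnit d := by
  rw [signedUnit_eq, signedUnit_eq d, smul_smul, ← pow_add]
  congr 2 <;> omega

theorem signedUnit_injective {c d : ℕ} (hc : c < 16) (hd : d < 16)
    (h : signedUnit c = signedUnit d) : c = d := by
  have h1 := congrFun h (unitIndex c)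
  simp only [signedUnit, Pi.smul_apply, Pi.single_apply, smul_eq_mul, if_true, mul_one] at h1
  by_cases he : unitIndex c = unitIndex d
  · rw [if_pos he, mul_one] at h1
    rw [unitIndex_eq_iff] at he
    have h2 : c / 8 = 0 ∨ c / 8 = 1 := by omega
    have h3 : d / 8 = 0 ∨ d / 8 = 1 := by omega
    rcases h2 with h2 | h2 <;> rcases h3 with h3 | h3 <;> rw [h2, h3] at h1
    · omega
    · norm_num at h1
    · norm_num at h1
    · omega
  · rw [if_neg he, mul_zero] at h1
    exact absurd h1 (pow_ne_zero _ (by norm_num))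

/-- The multiplication of octonions as a bilinear map. -/
noncomputable def octonionMulHom : Octonion →ₗ[ℝ] Octonion →ₗ[ℝ] Octonion :=
  LinearMap.mk₂ ℝ octonionMul
    (fun x x' y => by
      ext k; simp only [octonionMul, Pi.add_apply, ← Finset.sum_add_distrib]
      exact Finset.sum_congr rfl fun i _ => Finset.sum_congr rfl fun j _ => by ring)
    (fun c x y => by
      ext k; simp only [octonionMul, Pi.smul_apply, smul_eq_mul, Finset.mul_sum]
      exact Finset.sum_congr rfl fun i _ => Finset.sum_congr rfl fun j _ => by ring)
    (fun x y y' => by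
      ext k; simp only [octonionMul, Pi.add_apply, ← Finset.sum_add_distrib]
      exact Finset.sum_congr rfl fun i _ => Finset.sum_congr rfl fun j _ => by ring)
    (fun c x y => by
      ext k; simp only [octonionMul, Pi.smul_apply, smul_eq_mul, Finset.mul_sum]
      exact Finset.sum_congr rfl fun i _ => Finset.sum_congr rfl fun j _ => by ring)

theorem octonionMulHom_apply (x y : Octonion) : octonionMulHom x y = octonionMul x y := rfl

theorem octonionMul_single (i j k : Fin 8) :
    octonionMul (Pi.single i 1) (Pi.single j 1) k = (octonionStructureConst i j k : ℝ) := by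
  rw [octonionMul, Finset.sum_eq_single i, Finset.sum_eq_single j]
  · simp
  · intro b _ hb; simp [hb]
  · simp
  · intro b _ hb; simp [hb]
  · simp

theorem octonionMul_signedUnit {a b : ℕ} (ha : a < 16) (hb : b < 16) :
    octonionMul (signedUnit a) (signedUnit b) = signedUnit (signedUnitMul a b) := by
  ext k
  rw [← octonionMulHom_apply]
  simp only [signedUnit, map_smul, LinearMap.smul_apply, octonionMulHom_apply, Pi.smul_apply,
    octonionMul_single, Pi.single_apply, smul_eq_mul]
  have key : ∀ a < 16, ∀ b < 16, ∀ k : Fin 8, (-1 : ℤ) ^ (a / 8) * ((-1 : ℤ) ^ (b / 8) *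
      octonionStructureConst (unitIndex a) (unitIndex b) k) =
      (-1 : ℤ) ^ (signedUnitMul a b / 8) * if k = unitIndex (signedUnitMul a b) then 1 else 0 := by
    decide +kernel
  have := congrArg (Int.cast (R := ℝ)) (key a ha b hb k)
  push_cast at this
  linear_combination this

theorem octonionMul_one_left (x : Octonion) : octonionMul (signedUnit 0) x = x := by
  rw [signedUnit_of_lt (by norm_num), unitIndex_zero]
  ext k
  rw [octonionMul, Finset.sum_eq_single 0]
  · simp [octonionStructureConst]
  · intro i _ hi
    simp [hi]
  · simp

theorem octonionMul_one_right (x : Octonion) : octonionMul x (signedUnit 0) = x := by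
  rw [signedUnit_of_lt (by norm_num), unitIndex_zero]
  ext k
  rw [octonionMul, Finset.sum_comm, Finset.sum_eq_single 0]
  · rw [Finset.sum_eq_single k]
    · simp only [octonionStructureConst]
      by_cases hk : k = 0
      · simp [hk]
      · simp [hk]
    · intro i _ hi
      by_cases hi0 : i = 0
      · subst hi0; simp [octonionStructureConst, hi]
      · simp [octonionStructureConst, hi, hi0]
    · simp
  · intro i _ hi
    simp [hi]
  · simp

theorem mem_octonionSignedUnits_iff (x : Octonion) :
    x ∈ octonionSignedUnits ↔ ∃ d < 16, d % 8 ≠ 0 ∧ x = signedUnit d := by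
  have h0 : ∀ i < 8, unitIndex i = 0 → i = 0 := by decide
  constructor
  · rintro ⟨k, hk, hx⟩
    obtain ⟨i, hi, rfl⟩ := exists_unitIndex_eq k
    have hi0 : i ≠ 0 := by rintro rfl; exact hk rfl
    rcases hx with rfl | rfl
    · exact ⟨i, by omega, by omega, (signedUnit_of_lt hi).symm⟩
    · refine ⟨i + 1 * 8, by omega, by omega, ?_⟩
      rw [signedUnit_add_eight, signedUnit_of_lt hi]
      simp
  · rintro ⟨d, hd, hd0, rfl⟩
    refine ⟨unitIndex d, fun h => hd0 ?_, ?_⟩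
    · rw [← unitIndex_mod] at h
      exact h0 _ (Nat.mod_lt _ (by norm_num)) h
    · have h2 : d / 8 = 0 ∨ d / 8 = 1 := by omega
      rw [signedUnit]
      rcases h2 with h2 | h2 <;> simp [h2]

/-- The basis of the octonions given by the eight points. -/
theorem linearMap_ext_signedUnit {M : Type*} [AddCommGroup M] [Module ℝ M]
    {f g : Octonion →ₗ[ℝ] M} (h : ∀ i < 8, f (signedUnit i) = g (signedUnit i)) : f = g := by
  refine (Pi.basisFun ℝ (Fin 8)).ext fun k => ?_
  obtain ⟨i, hi, rfl⟩ := exists_unitIndex_eq k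
  rw [Pi.basisFun_apply, ← signedUnit_of_lt hi, h i hi]

theorem mem_automorphismCodes {p : ℕ} (hp : p = pack (digit p)) (h0 : digit p 0 = 0)
    (hne : ∀ i j, i < 8 → j < 8 → i ≠ j → digit p i % 8 ≠ digit p j % 8)
    (e3 : digit p 3 = signedUnitMul (digit p 1) (digit p 2))
    (e5 : digit p 5 = signedUnitMul (digit p 1) (digit p 4))
    (e6 : digit p 6 = signedUnitMul (digit p 2) (digit p 4))
    (e7 : digit p 7 = (signedUnitMul (signedUnitMul (digit p 1) (digit p 2)) (digit p 4) + 8) % 16)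
    (hx : digit p 4 % 8 ≠ (digit p 1 % 8) ^^^ (digit p 2 % 8)) : p ∈ automorphismCodes := by
  have hcode : p = automorphismCode (digit p 1) (digit p 2) (digit p 4) := by
    conv_lhs => rw [hp]
    refine pack_congr fun i hi => ?_
    interval_cases i
    exacts [h0, rfl, rfl, e3, rfl, e5, e6, e7]
  have n1 := hne 1 0 (by norm_num) (by norm_num) (by norm_num)
  have n2 := hne 2 0 (by norm_num) (by norm_num) (by norm_num)
  have n3 := hne 2 1 (by norm_num) (by norm_num) (by norm_num)
  have n4 := hne 4 0 (by norm_num) (by norm_num) (by norm_num)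
  have n5 := hne 4 1 (by norm_num) (by norm_num) (by norm_num)
  have n6 := hne 4 2 (by norm_num) (by norm_num) (by norm_num)
  rw [h0, Nat.zero_mod] at n1 n2 n4
  rw [automorphismCodes, List.mem_flatMap]
  refine ⟨_, List.mem_range.2 (digit_lt p 1), ?_⟩
  rw [if_neg n1, List.mem_flatMap]
  refine ⟨_, List.mem_range.2 (digit_lt p 2), ?_⟩
  rw [if_neg (by tauto), List.mem_flatMap]
  refine ⟨_, List.mem_range.2 (digit_lt p 4), ?_⟩
  rw [if_neg (by tauto), List.mem_singleton]
  exact hcode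

namespace octonionUnitAut

theorem map_mul (f : octonionUnitAut) (x y : Octonion) :
    f.1 (octonionMul x y) = octonionMul (f.1 x) (f.1 y) := f.2.1 x y

theorem map_one (f : octonionUnitAut) : f.1 (signedUnit 0) = signedUnit 0 := by
  have h := map_mul f (signedUnit 0) (f.1.symm (signedUnit 0))
  rwa [octonionMul_one_left, LinearEquiv.apply_symm_apply, octonionMul_one_right, eq_comm] at h

theorem exists_signedUnit (f : octonionUnitAut) (i : ℕ) :
    ∃ d < 16, f.1 (signedUnit i) = signedUnit d := by
  by_cases h0 : i % 8 = 0
  · rw [signedUnit_eq, h0, map_smul, map_one]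
    refine ⟨(0 + i / 8 * 8) % 16, Nat.mod_lt _ (by norm_num), ?_⟩
    rw [signedUnit_mod, signedUnit_add_eight]
  · have h1 : f.1 (signedUnit i) ∈ octonionSignedUnits := by
      rw [← f.2.2]
      refine Set.mem_image_of_mem _ ((mem_octonionSignedUnits_iff _).2
        ⟨i % 16, Nat.mod_lt _ (by norm_num), by omega, (signedUnit_mod i).symm⟩)
    obtain ⟨d, hd, -, he⟩ := (mem_octonionSignedUnits_iff _).1 h1
    exact ⟨d, hd, he⟩

/-- The code of an automorphism of the octonionic set. -/
noncomputable def code (f : octonionUnitAut) : ℕ := pack fun i => (exists_signedUnit f i).choose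

theorem apply_signedUnit (f : octonionUnitAut) (d : ℕ) :
    f.1 (signedUnit d) = signedUnit (signedApply (code f) d) := by
  rw [signedApply, signedUnit_mod, signedUnit_add_eight, code, digit_pack
    (fun i => (exists_signedUnit f i).choose_spec.1) (Nat.mod_lt _ (by norm_num)),
    ← (exists_signedUnit f (d % 8)).choose_spec.2, ← map_smul, ← signedUnit_eq]

theorem signedApply_of_lt {p i : ℕ} (hi : i < 8) : signedApply p i = digit p i := by
  rw [signedApply, Nat.mod_eq_of_lt hi, Nat.div_eq_of_lt hi, zero_mul, add_zero,
    Nat.mod_eq_of_lt (digit_lt p i)]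

theorem code_eq_of_forall {f : octonionUnitAut} {d : ℕ → ℕ} (hd : ∀ i, d i < 16)
    (h : ∀ i < 8, f.1 (signedUnit i) = signedUnit (d i)) : code f = pack d := by
  refine pack_congr fun i hi => ?_
  have h1 := (exists_signedUnit f i).choose_spec
  exact signedUnit_injective h1.1 (hd i) (by rw [← h1.2, h i hi])

theorem signedUnitMul_lt (a b : ℕ) : signedUnitMul a b < 16 := by
  have : (a % 8) ^^^ (b % 8) < 2 ^ 3 :=
    Nat.xor_lt_two_pow (Nat.mod_lt _ (by norm_num)) (Nat.mod_lt _ (by norm_num))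
  rw [signedUnitMul]
  omega

theorem signedApply_signedUnitMul (f : octonionUnitAut) {i j : ℕ} (hi : i < 8) (hj : j < 8) :
    signedApply (code f) (signedUnitMul i j) =
      signedUnitMul (digit (code f) i) (digit (code f) j) := by
  refine signedUnit_injective (signedApply_lt _ _) (signedUnitMul_lt _ _) ?_
  rw [← apply_signedUnit, ← octonionMul_signedUnit (by omega) (by omega), map_mul,
    ← octonionMul_signedUnit (digit_lt _ _) (digit_lt _ _), apply_signedUnit, apply_signedUnit,
    signedApply_of_lt hi, signedApply_of_lt hj]

theorem digit_code_zero (f : octonionUnitAut) : digit (code f) 0 = 0 := by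
  rw [← signedApply_of_lt (by norm_num)]
  exact signedUnit_injective (signedApply_lt _ _) (by norm_num)
    (by rw [← apply_signedUnit, map_one])

theorem eq_of_digit_mod_eq (f : octonionUnitAut) {i j : ℕ} (hi : i < 8) (hj : j < 8)
    (h : digit (code f) i % 8 = digit (code f) j % 8) : i = j := by
  have h1 := apply_signedUnit f i
  have h2 := apply_signedUnit f j
  rw [signedApply_of_lt hi] at h1
  rw [signedApply_of_lt hj] at h2
  have h3 : signedUnit (digit (code f) i) = signedUnit (digit (code f) j) ∨
      signedUnit (digit (code f) i) = (-1 : ℝ) ^ 1 • signedUnit (digit (code f) j) := by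
    have e1 := digit_lt (code f) i
    have e2 := digit_lt (code f) j
    generalize digit (code f) i = a at *
    generalize digit (code f) j = b at *
    by_cases hab : a = b
    · exact Or.inl (by rw [hab])
    · right
      rw [← signedUnit_add_eight, ← signedUnit_mod (b + 1 * 8)]
      congr 1
      omega
  rw [← h1, ← h2, ← map_smul, f.1.injective.eq_iff, f.1.injective.eq_iff,
    ← signedUnit_add_eight] at h3
  rcases h3 with h3 | h3
  · exact signedUnit_injective (by omega) (by omega) h3
  · have := signedUnit_injective (by omega) (by omega) h3
    omega

/-- An automorphism is determined by the images of the points `1`, `2`, `4`, since the others are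
products of these. -/
theorem code_mem (f : octonionUnitAut) : code f ∈ automorphismCodes := by
  have hne : ∀ i j, i < 8 → j < 8 → i ≠ j → digit (code f) i % 8 ≠ digit (code f) j % 8 :=
    fun i j hi hj hij h => hij (eq_of_digit_mod_eq f hi hj h)
  have h0 := digit_code_zero f
  have hm : ∀ i j, i < 8 → j < 8 → signedApply (code f) (signedUnitMul i j) =
      signedUnitMul (digit (code f) i) (digit (code f) j) :=
    fun i j hi hj => signedApply_signedUnitMul f hi hj
  have e3 : digit (code f) 3 = signedUnitMul (digit (code f) 1) (digit (code f) 2) := by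
    rw [← hm 1 2 (by norm_num) (by norm_num), show signedUnitMul 1 2 = 3 by decide,
      signedApply_of_lt (by norm_num)]
  have e5 : digit (code f) 5 = signedUnitMul (digit (code f) 1) (digit (code f) 4) := by
    rw [← hm 1 4 (by norm_num) (by norm_num), show signedUnitMul 1 4 = 5 by decide,
      signedApply_of_lt (by norm_num)]
  have e6 : digit (code f) 6 = signedUnitMul (digit (code f) 2) (digit (code f) 4) := by
    rw [← hm 2 4 (by norm_num) (by norm_num), show signedUnitMul 2 4 = 6 by decide,
      signedApply_of_lt (by norm_num)]
  have e7 : digit (code f) 7 =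
      (signedUnitMul (signedUnitMul (digit (code f) 1) (digit (code f) 2)) (digit (code f) 4) + 8)
        % 16 := by
    have := hm 3 4 (by norm_num) (by norm_num)
    rw [← e3, ← this, show signedUnitMul 3 4 = 15 by decide, signedApply,
      show 15 % 8 = 7 by norm_num]
    have := digit_lt (code f) 7
    omega
  have hx : digit (code f) 4 % 8 ≠ (digit (code f) 1 % 8) ^^^ (digit (code f) 2 % 8) := by
    have h34 := hne 4 3 (by norm_num) (by norm_num) (by norm_num)
    rw [e3, signedUnitMul] at h34
    have : (digit (code f) 1 % 8) ^^^ (digit (code f) 2 % 8) < 2 ^ 3 :=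
      Nat.xor_lt_two_pow (Nat.mod_lt _ (by norm_num)) (Nat.mod_lt _ (by norm_num))
    omega
  exact mem_automorphismCodes (code_eq_of_forall (digit_lt _) fun i hi => by
    rw [apply_signedUnit, signedApply_of_lt hi]) h0 (fun i j hi hj => hne i j hi hj) e3 e5 e6 e7 hx

/-- The linear map that acts on the signed units by the code `p`. -/
noncomputable def linearMapOfCode (p : ℕ) : Octonion →ₗ[ℝ] Octonion :=
  (Pi.basisFun ℝ (Fin 8)).constr ℝ fun k => signedUnit (digit p (exists_unitIndex_eq k).choose)

theorem linearMapOfCode_signedUnit (p d : ℕ) :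
    linearMapOfCode p (signedUnit d) = signedUnit (signedApply p d) := by
  have h8 : d % 8 < 8 := Nat.mod_lt _ (by norm_num)
  have h1 : linearMapOfCode p (signedUnit (d % 8)) = signedUnit (digit p (d % 8)) := by
    have hs := (exists_unitIndex_eq (unitIndex (d % 8))).choose_spec
    rw [signedUnit_of_lt h8, ← Pi.basisFun_apply, linearMapOfCode, Module.Basis.constr_basis]
    have := unitIndex_eq_iff.1 hs.2
    rw [Nat.mod_eq_of_lt hs.1, Nat.mod_mod] at this
    rw [this]
  rw [signedUnit_eq, map_smul, h1, signedApply, signedUnit_mod, signedUnit_add_eight]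

/-- Conversely, a map in the list extends to a linear automorphism. -/
theorem exists_code_eq {p : ℕ} (hp : p ∈ automorphismCodes) : ∃ f, code f = p := by
  have hmul : ∀ i < 8, ∀ j < 8,
      signedUnitMul (digit p i) (digit p j) = signedApply p (signedUnitMul i j) := by
    have := List.all_eq_true.1 automorphismCodes_map_mul p hp
    simpa only [List.all_eq_true, List.mem_range, Nat.beq_eq] using this
  have hbij := List.all_eq_true.1 automorphismCodes_bijective p hp
  simp only [Bool.and_eq_true, beq_iff_eq, List.all_eq_true, List.mem_range, Bool.or_eq_true,
    bne_iff_ne, List.any_eq_true] at hbij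
  obtain ⟨⟨hpack, h0⟩, hbij⟩ := hbij
  have hsurj : Function.Surjective (linearMapOfCode p) := by
    rw [← LinearMap.range_eq_top, eq_top_iff, ← (Pi.basisFun ℝ (Fin 8)).span_eq,
      Submodule.span_le]
    rintro _ ⟨k, rfl⟩
    obtain ⟨i, hi, rfl⟩ := exists_unitIndex_eq k
    obtain ⟨j, hj, hji⟩ := (hbij i hi).2
    rw [Pi.basisFun_apply, ← signedUnit_of_lt hi]
    refine ⟨(-1 : ℝ) ^ (digit p j / 8) • signedUnit j, ?_⟩
    rw [map_smul, linearMapOfCode_signedUnit, signedApply_of_lt hj, signedUnit_eq, smul_smul,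
      ← pow_add, hji, Even.neg_one_pow ⟨_, rfl⟩, one_smul]
  let e : Octonion ≃ₗ[ℝ] Octonion :=
    LinearEquiv.ofBijective (linearMapOfCode p) ⟨LinearMap.injective_iff_surjective.2 hsurj, hsurj⟩
  have he : ∀ x, e x = linearMapOfCode p x := fun x => rfl
  have hm : octonionMulHom.compr₂ (linearMapOfCode p) =
      octonionMulHom.compl₁₂ (linearMapOfCode p) (linearMapOfCode p) := by
    refine linearMap_ext_signedUnit fun i hi => linearMap_ext_signedUnit fun j hj => ?_
    simp only [LinearMap.compr₂_apply, LinearMap.compl₁₂_apply, octonionMulHom_apply,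
      linearMapOfCode_signedUnit]
    rw [octonionMul_signedUnit (by omega) (by omega), linearMapOfCode_signedUnit,
      octonionMul_signedUnit (signedApply_lt _ _) (signedApply_lt _ _), signedApply_of_lt hi,
      signedApply_of_lt hj, hmul i hi j hj]
  have hfin : octonionSignedUnits.Finite := by
    refine ((Set.finite_lt_nat 16).image signedUnit).subset fun x hx => ?_
    obtain ⟨d, hd, -, rfl⟩ := (mem_octonionSignedUnits_iff x).1 hx
    exact Set.mem_image_of_mem _ hd
  have hset : e '' octonionSignedUnits = octonionSignedUnits := by
    refine Set.eq_of_subset_of_ncard_le ?_ (Set.ncard_image_of_injective _ e.injective).ge hfin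
    rintro _ ⟨x, hx, rfl⟩
    obtain ⟨d, hd, hd0, rfl⟩ := (mem_octonionSignedUnits_iff x).1 hx
    rw [he, linearMapOfCode_signedUnit, mem_octonionSignedUnits_iff]
    refine ⟨_, signedApply_lt _ _, ?_, rfl⟩
    have := ((hbij (d % 8) (Nat.mod_lt _ (by norm_num))).1).resolve_left hd0
    rw [signedApply]
    omega
  let f : octonionUnitAut := ⟨e, fun x y => LinearMap.congr_fun (LinearMap.congr_fun hm x) y, hset⟩
  refine ⟨f, ?_⟩
  rw [hpack]
  refine code_eq_of_forall (digit_lt p) fun i hi => ?_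
  change linearMapOfCode p (signedUnit i) = _
  rw [linearMapOfCode_signedUnit, signedApply_of_lt hi]

theorem isCoding : IsCoding code automorphismCodes where
  injective f g h := by
    apply Subtype.ext
    apply LinearEquiv.toLinearMap_injective
    refine linearMap_ext_signedUnit fun i _ => ?_
    rw [LinearEquiv.coe_coe, LinearEquiv.coe_coe, apply_signedUnit, apply_signedUnit, h]
  -- Only the digits with `i < 8` matter; beyond, any value below `16` will do.
  map_one := code_eq_of_forall (f := 1) (d := fun i => if i < 16 then i else 0)
    (fun i => by split_ifs <;> omega) (fun i hi => by rw [if_pos (by omega)]; rfl)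
  map_mul f g := code_eq_of_forall (fun _ => signedApply_lt _ _) fun i hi => by
    rw [← signedApply_of_lt hi, ← apply_signedUnit, ← apply_signedUnit]
    rfl
  mem_iff p := ⟨exists_code_eq, by rintro ⟨f, rfl⟩; exact code_mem f⟩

end octonionUnitAut

end OctonionCoding

/-! ### Coding the affine group and actions on eight points -/

section AffineCoding

/-- The code of a permutation of eight points labelled by `e`. -/
def actCode {X : Type} (e : X ≃ Fin 8) (σ : X → X) : ℕ :=
  pack fun i => e (σ (e.symm (Fin.ofNat 8 i)))

section

variable {X : Type} (e : X ≃ Fin 8)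

theorem digit_actCode (σ : X → X) {i : ℕ} (hi : i < 8) :
    digit (actCode e σ) i = e (σ (e.symm (Fin.ofNat 8 i))) :=
  digit_pack (fun _ => (Fin.is_lt _).trans (by norm_num)) hi

theorem digit_actCode_apply (σ : X → X) (x : X) : digit (actCode e σ) (e x) = e (σ x) := by
  rw [digit_actCode e σ (e x).2, Fin.ofNat_eq_cast, Fin.cast_val_eq_self, e.symm_apply_apply]

theorem actCode_injective : Function.Injective (actCode e) := by
  intro σ τ h
  ext x
  rw [← e.injective.eq_iff, Fin.ext_iff, ← digit_actCode_apply, ← digit_actCode_apply, h]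

theorem actCode_comp (σ τ : X → X) : actCode e (σ ∘ τ) = codeComp (actCode e σ) (actCode e τ) := by
  refine pack_congr fun i hi => ?_
  have h := (e (τ (e.symm (Fin.ofNat 8 i)))).2
  rw [digit_actCode e τ hi, signedApply, Nat.mod_eq_of_lt h, Nat.div_eq_of_lt h, zero_mul, add_zero,
    Nat.mod_eq_of_lt (digit_lt _ _), digit_actCode_apply]
  rfl

theorem actCode_id : actCode e id = codeOne := by
  refine pack_congr fun i hi => ?_
  simp [Nat.mod_eq_of_lt hi]

end

/-- The labelling of the vectors of `𝔽₂³` by three-bit numbers. -/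
def vectorEquiv : ElemAbEight ≃ Fin 8 where
  toFun x := Fin.ofNat 8 ((x.toAdd 0).val + 2 * (x.toAdd 1).val + 4 * (x.toAdd 2).val)
  invFun i := Multiplicative.ofAdd ![(i : ℕ), (i / 2 : ℕ), (i / 4 : ℕ)]
  left_inv := by unfold Function.LeftInverse; decide
  right_inv := by unfold Function.RightInverse Function.LeftInverse; decide

theorem vectorEquiv_mul (x y : ElemAbEight) :
    (vectorEquiv (x * y) : ℕ) = vectorEquiv x ^^^ vectorEquiv y := by
  revert x y; decide +kernel

theorem vectorEquiv_one : vectorEquiv 1 = 0 := by decide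

theorem vectorEquiv_symm_mul (i j : Fin 8) :
    vectorEquiv.symm i * vectorEquiv.symm j = vectorEquiv.symm (i ^^^ j) := by
  revert i j; decide +kernel

attribute [irreducible] vectorEquiv

theorem vectorEquiv_symm_zero : vectorEquiv.symm 0 = 1 := by
  rw [Equiv.symm_apply_eq, vectorEquiv_one]

theorem card_mulAut_elemAbEight : Nat.card (MulAut ElemAbEight) = 168 := by
  have e1 : MulAut ElemAbEight ≃ AddAut (Fin 3 → ZMod 2) :=
    (MulAutMultiplicative (Fin 3 → ZMod 2)).toEquiv.trans Multiplicative.toAdd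
  have e2 : AddAut (Fin 3 → ZMod 2) ≃ ((Fin 3 → ZMod 2) ≃ₗ[ZMod 2] (Fin 3 → ZMod 2)) :=
    { toFun := fun f => LinearEquiv.ofBijective
        (AddMonoidHom.toZModLinearMap 2 (AddEquiv.toAddMonoidHom f)) (AddEquiv.bijective f)
      invFun := fun f => f.toAddEquiv
      left_inv := fun f => by ext; rfl
      right_inv := fun f => by ext; rfl }
  have e3 : GL (Fin 3) (ZMod 2) ≃ ((Fin 3 → ZMod 2) ≃ₗ[ZMod 2] (Fin 3 → ZMod 2)) :=
    (Matrix.GeneralLinearGroup.toLin.trans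
      (LinearMap.GeneralLinearGroup.generalLinearEquiv _ _)).toEquiv
  rw [Nat.card_congr ((e1.trans e2).trans e3.symm), Matrix.card_GL_field]
  simp [Fin.prod_univ_succ, ZMod.card]

theorem affineCode_mem {v a b c : ℕ} (hv : v < 8) (ha : a < 8) (hb : b < 8) (hc : c < 8)
    (ha0 : a ≠ 0) (hb0 : ¬ (b = 0 ∨ b = a)) (hc0 : ¬ (c = 0 ∨ c = a ∨ c = b ∨ c = a ^^^ b)) :
    affineCode v a b c ∈ affineCodes := by
  rw [affineCodes, List.mem_flatMap]
  refine ⟨v, List.mem_range.2 hv, List.mem_flatMap.2 ⟨a, List.mem_range.2 ha, ?_⟩⟩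
  rw [if_neg ha0, List.mem_flatMap]
  refine ⟨b, List.mem_range.2 hb, ?_⟩
  rw [if_neg hb0, List.mem_flatMap]
  refine ⟨c, List.mem_range.2 hc, ?_⟩
  rw [if_neg hc0, List.mem_singleton]

namespace AffineGroup

variable {K : Type} [Group K] (φ : K ≃* MulAut ElemAbEight)

/-- The affine map of `𝔽₂³` given by an element of the semidirect product. -/
def affineMap (g : ElemAbEight ⋊[φ.toMonoidHom] K) (x : ElemAbEight) : ElemAbEight :=
  g.left * φ g.right x

/-- The code of an element of the semidirect product. -/
def code (g : ElemAbEight ⋊[φ.toMonoidHom] K) : ℕ := actCode vectorEquiv (affineMap φ g)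

/-- The code of the linear part of an element of the semidirect product. -/
def lin (g : ElemAbEight ⋊[φ.toMonoidHom] K) : ℕ := actCode vectorEquiv (φ g.right)

theorem affineMap_mul (g h : ElemAbEight ⋊[φ.toMonoidHom] K) :
    affineMap φ (g * h) = affineMap φ g ∘ affineMap φ h := by
  funext x
  rw [affineMap, SemidirectProduct.mul_left, SemidirectProduct.mul_right, map_mul, mul_assoc,
    Function.comp_apply, affineMap, affineMap, map_mul]
  rfl

theorem code_injective : Function.Injective (code φ) := by
  intro g h hgh
  have h1 := actCode_injective vectorEquiv hgh
  have hl : g.left = h.left := by simpa [affineMap] using congrFun h1 1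
  refine SemidirectProduct.ext hl (φ.injective ?_)
  ext1 x
  simpa [affineMap, hl] using congrFun h1 x

theorem code_mul (g h : ElemAbEight ⋊[φ.toMonoidHom] K) :
    code φ (g * h) = codeComp (code φ g) (code φ h) := by
  rw [code, affineMap_mul, actCode_comp]
  rfl

theorem code_one : code φ 1 = codeOne := by
  rw [← actCode_id vectorEquiv, code]
  congr 1
  ext1 x
  simp [affineMap]

theorem lin_mul (g h : ElemAbEight ⋊[φ.toMonoidHom] K) :
    lin φ (g * h) = codeComp (lin φ g) (lin φ h) := by
  rw [lin, lin, lin, ← actCode_comp, SemidirectProduct.mul_right, map_mul]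
  rfl

theorem lin_one : lin φ 1 = codeOne := by
  rw [← actCode_id vectorEquiv, lin, SemidirectProduct.one_right, map_one]
  rfl

theorem digit_code (g : ElemAbEight ⋊[φ.toMonoidHom] K) {i : ℕ} (hi : i < 8) :
    digit (code φ g) i =
      vectorEquiv g.left ^^^ vectorEquiv (φ g.right (vectorEquiv.symm (Fin.ofNat 8 i))) := by
  rw [code, digit_actCode _ _ hi, affineMap, vectorEquiv_mul]

theorem codeLin_code (g : ElemAbEight ⋊[φ.toMonoidHom] K) : codeLin (code φ g) = lin φ g := by
  rw [codeLin, lin, actCode]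
  refine pack_congr fun i hi => ?_
  have h0 : vectorEquiv.symm (Fin.ofNat 8 0) = 1 := vectorEquiv_symm_zero
  have hlt : ∀ j < 8, digit (code φ g) j % 8 = digit (code φ g) j := fun j hj =>
    Nat.mod_eq_of_lt (by rw [code, digit_actCode _ _ hj]; exact Fin.is_lt _)
  rw [hlt i hi, hlt 0 (by norm_num), digit_code φ g hi, digit_code φ g (by norm_num), h0, map_one,
    vectorEquiv_one, Fin.val_zero, Nat.xor_zero, Nat.xor_comm, ← Nat.xor_assoc, Nat.xor_self,
    Nat.zero_xor]

theorem code_mem (g : ElemAbEight ⋊[φ.toMonoidHom] K) : code φ g ∈ affineCodes := by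
  let y : ℕ → ElemAbEight := fun i => φ g.right (vectorEquiv.symm (Fin.ofNat 8 i))
  have hinj : ∀ i < 8, ∀ j < 8, i ≠ j → (vectorEquiv (y i) : ℕ) ≠ vectorEquiv (y j) := by
    intro i hi j hj hij h
    rw [← Fin.ext_iff, vectorEquiv.injective.eq_iff, (φ g.right).injective.eq_iff,
      vectorEquiv.symm.injective.eq_iff, Fin.ext_iff] at h
    simp only [Fin.val_ofNat] at h
    omega
  have h0 : (vectorEquiv (y 0) : ℕ) = 0 := by
    have : vectorEquiv.symm (Fin.ofNat 8 0) = 1 := vectorEquiv_symm_zero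
    simp only [y, this, map_one, vectorEquiv_one, Fin.val_zero]
  have hmul : ∀ i j k : ℕ, Fin.ofNat 8 i ^^^ Fin.ofNat 8 j = Fin.ofNat 8 k →
      (vectorEquiv (y k) : ℕ) = vectorEquiv (y i) ^^^ vectorEquiv (y j) := by
    intro i j k h
    rw [← vectorEquiv_mul, ← map_mul, vectorEquiv_symm_mul, h]
  have h3 := hmul 1 2 3 (by decide)
  have h5 := hmul 1 4 5 (by decide)
  have h6 := hmul 2 4 6 (by decide)
  have h7 := hmul 3 4 7 (by decide)
  have hd : ∀ i < 8, (vectorEquiv (affineMap φ g (vectorEquiv.symm (Fin.ofNat 8 i))) : ℕ) =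
      vectorEquiv g.left ^^^ vectorEquiv (y i) := fun i hi => vectorEquiv_mul _ _
  clear_value y
  have hcode : code φ g = affineCode (vectorEquiv g.left) (vectorEquiv (y 1)) (vectorEquiv (y 2))
      (vectorEquiv (y 4)) := by
    refine pack_congr fun i hi => (hd i hi).trans ?_
    interval_cases i
    · simp [h0]
    · simp
    · simp
    · simp [h3, Nat.xor_assoc]
    · simp
    · simp [h5, Nat.xor_assoc]
    · simp [h6, Nat.xor_assoc]
    · simp [h7, h3, Nat.xor_assoc]
  rw [hcode]
  refine affineCode_mem (Fin.is_lt _) (Fin.is_lt _) (Fin.is_lt _) (Fin.is_lt _) ?_ ?_ ?_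
  · rw [← h0]; exact hinj 1 (by norm_num) 0 (by norm_num) (by norm_num)
  · rw [← h0]
    exact not_or.2 ⟨hinj 2 (by norm_num) 0 (by norm_num) (by norm_num),
      hinj 2 (by norm_num) 1 (by norm_num) (by norm_num)⟩
  · rw [← h0, ← show _ = _ from h3]
    simp only [not_or]
    exact ⟨hinj 4 (by norm_num) 0 (by norm_num) (by norm_num),
      hinj 4 (by norm_num) 1 (by norm_num) (by norm_num),
      hinj 4 (by norm_num) 2 (by norm_num) (by norm_num),
      hinj 4 (by norm_num) 3 (by norm_num) (by norm_num)⟩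

/-- All codes occur because both sides have `8 * 168 = 1344` elements. -/
theorem isCoding : IsCoding (code φ) affineCodes where
  injective := code_injective φ
  map_one := code_one φ
  map_mul := code_mul φ
  mem_iff p := by
    refine ⟨fun hp => ?_, by rintro ⟨g, rfl⟩; exact code_mem φ g⟩
    have hcard : Nat.card (ElemAbEight ⋊[φ.toMonoidHom] K) = 1344 := by
      rw [SemidirectProduct.card, Nat.card_congr φ.toEquiv, card_mulAut_elemAbEight,
        Nat.card_congr vectorEquiv, Nat.card_eq_fintype_card, Fintype.card_fin]
    have hfin : Finite (ElemAbEight ⋊[φ.toMonoidHom] K) :=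
      Nat.finite_of_card_ne_zero (by rw [hcard]; norm_num)
    have hsub : Set.range (code φ) ⊆ {p | p ∈ affineCodes} := by
      rintro _ ⟨g, rfl⟩
      exact code_mem φ g
    have hL : {p | p ∈ affineCodes}.ncard = 1344 := by
      rw [← List.coe_toFinset, Set.ncard_coe_finset,
        List.toFinset_card_of_nodup isClassSystem_affineCodes.nodup,
        isClassSystem_affineCodes.length]
    have heq := Set.eq_of_subset_of_ncard_le hsub
      (by rw [hL, Set.ncard_range_of_injective (code_injective φ), hcard])
      (affineCodes.finite_toSet)
    exact heq.symm.subset hp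

theorem table : HasCharacterTable (ElemAbEight ⋊[φ.toMonoidHom] K) commonCharacterTable
    commonClassSizes splitClassOrders ∧ RealExceptDegreeThree (ElemAbEight ⋊[φ.toMonoidHom] K) :=
  (isCoding φ).table isClassSystem_affineCodes (lin_one φ) (lin_mul φ)
    (l := fun j => codeLin (affineReps j))
    (fun j => by rw [← codeLin_code, (isCoding φ).code_rep])
    codeTrace_affineReps codeTrace_codeLin_affineReps codeTraceSym_codeLin_affineReps
    (Or.inr codeTraceSym_affineReps)

end AffineGroup

namespace octonionUnitAut

/-- Since the unit is fixed, the linear part of an automorphism just forgets the signs. -/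
theorem codeLin_code_mul (f g : octonionUnitAut) :
    codeLin (code (f * g)) = codeComp (codeLin (code f)) (codeLin (code g)) := by
  have hd : ∀ (f : octonionUnitAut) {i : ℕ}, i < 8 →
      digit (codeLin (code f)) i = digit (code f) i % 8 := by
    intro f i hi
    rw [codeLin, digit_pack _ hi]
    · rw [digit_code_zero, Nat.zero_mod, Nat.xor_zero]
    · intro i
      rw [digit_code_zero, Nat.zero_mod, Nat.xor_zero]
      omega
  refine pack_congr fun i hi => ?_
  rw [digit_code_zero, Nat.zero_mod, Nat.xor_zero, isCoding.map_mul, digit_codeComp _ _ hi, hd g hi,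
    signedApply, signedApply, Nat.mod_mod, hd f (Nat.mod_lt _ (by norm_num))]
  omega

theorem codeLin_code_one : codeLin (code 1) = codeOne := by
  rw [isCoding.map_one]
  decide

theorem table : HasCharacterTable octonionUnitAut commonCharacterTable commonClassSizes
    nonSplitClassOrders ∧ RealExceptDegreeThree octonionUnitAut :=
  isCoding.table isClassSystem_automorphismCodes (lin := fun f => codeLin (code f)) codeLin_code_one
    codeLin_code_mul
    (l := fun j => codeLin (automorphismReps j)) (fun j => by rw [isCoding.code_rep])
    codeTrace_automorphismReps codeTrace_codeLin_automorphismReps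
    codeTraceSym_codeLin_automorphismReps (Or.inl codeTraceSym_automorphismReps)

end octonionUnitAut

end AffineCoding

/-! ### The projective line over `𝔽₇` as an affine space over `𝔽₂` -/

section ProjectiveLine

open Matrix

instance fact_prime_seven : Fact (Nat.Prime 7) := ⟨by norm_num⟩

/-- The labelling of the projective line over `𝔽₇` by three-bit numbers. It turns the elements of
`PSL₂(7)` into affine maps. -/
def projectiveLineEquiv : OnePoint (ZMod 7) ≃ Fin 8 where
  toFun x := x.elim 0 (![1, 2, 4, 3, 6, 7, 5] : ZMod 7 → Fin 8)
  invFun := ![none, some 0, some 1, some 3, some 2, some 6, some 4, some 5]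
  left_inv := by
    rintro (_ | x)
    · rfl
    · have h : ∀ x : ZMod 7,
          (![none, some 0, some 1, some 3, some 2, some 6, some 4, some 5] : Fin 8 →
            Option (ZMod 7)) ((![1, 2, 4, 3, 6, 7, 5] : ZMod 7 → Fin 8) x) = some x := by decide
      exact h x
  right_inv := by unfold Function.RightInverse Function.LeftInverse; decide

/-- The fractional linear map with the given coefficients, where `x⁻¹` is written as `x ^ 5`. -/
def fractionalLinear (a b c d : ZMod 7) (x : OnePoint (ZMod 7)) : OnePoint (ZMod 7) :=
  x.elim (if c = 0 then none else some (a * c ^ 5)) fun x =>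
    if c * x + d = 0 then none else some ((a * x + b) * (c * x + d) ^ 5)

theorem smul_onePoint_eq_fractionalLinear (M : SpecialLinearGroup (Fin 2) (ZMod 7))
    (x : OnePoint (ZMod 7)) :
    M.toGL • x = fractionalLinear (M 0 0) (M 0 1) (M 1 0) (M 1 1) x := by
  have hinv : ∀ y : ZMod 7, y⁻¹ = y ^ 5 := by decide +kernel
  induction x using OnePoint.rec with
  | infty =>
    rw [OnePoint.smul_infty_eq_ite, div_eq_mul_inv, hinv]
    rfl
  | coe x =>
    rw [OnePoint.smul_some_eq_ite, div_eq_mul_inv, hinv]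
    rfl

/-- The code of the fractional linear map of a matrix. -/
def fractionalLinearCode (a b c d : ZMod 7) : ℕ :=
  actCode projectiveLineEquiv (fractionalLinear a b c d)

/-- In terms of the images `p` of the points `0`, `1`, `2`, `4`, the map is the affine map
`x ↦ p₀ + x₀ (p₁ + p₀) + x₁ (p₂ + p₀) + x₂ (p₄ + p₀)`, with independent coefficients. -/
theorem fractionalLinearCode_isAffine : ∀ a b c d : ZMod 7, a * d - b * c = 1 →
    (fun p v x y z => p = affineCode v x y z ∧ v < 8 ∧ x < 8 ∧ y < 8 ∧ z < 8 ∧ x ≠ 0 ∧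
      ¬ (y = 0 ∨ y = x) ∧ ¬ (z = 0 ∨ z = x ∨ z = y ∨ z = x ^^^ y))
      (fractionalLinearCode a b c d) (digit (fractionalLinearCode a b c d) 0)
      (digit (fractionalLinearCode a b c d) 1 ^^^ digit (fractionalLinearCode a b c d) 0)
      (digit (fractionalLinearCode a b c d) 2 ^^^ digit (fractionalLinearCode a b c d) 0)
      (digit (fractionalLinearCode a b c d) 4 ^^^ digit (fractionalLinearCode a b c d) 0) := by
  decide +kernel

/-- Only scalar matrices act by translations. -/
theorem codeLin_fractionalLinearCode : ∀ a b c d : ZMod 7, a * d - b * c = 1 →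
    (codeLin (fractionalLinearCode a b c d) = codeOne ↔ b = 0 ∧ c = 0 ∧ a = d) := by
  decide +kernel

/-- The affine group of `𝔽₂³`. -/
abbrev AffineGroupEight : Type :=
  ElemAbEight ⋊[(MulEquiv.refl (MulAut ElemAbEight)).toMonoidHom] MulAut ElemAbEight

theorem fractionalLinearCode_eq (M : SpecialLinearGroup (Fin 2) (ZMod 7)) :
    fractionalLinearCode (M 0 0) (M 0 1) (M 1 0) (M 1 1) =
      actCode projectiveLineEquiv (M.toGL • ·) := by
  simp only [fractionalLinearCode, smul_onePoint_eq_fractionalLinear]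

theorem exists_code_eq_actCode (M : SpecialLinearGroup (Fin 2) (ZMod 7)) :
    ∃ g : AffineGroupEight, AffineGroup.code (.refl _) g =
      actCode projectiveLineEquiv (M.toGL • ·) := by
  rw [← AffineGroup.isCoding _ |>.mem_iff, ← fractionalLinearCode_eq]
  obtain ⟨h, h1, h2, h3, h4, h5, h6, h7⟩ := fractionalLinearCode_isAffine _ _ _ _
    (show M 0 0 * M 1 1 - M 0 1 * M 1 0 = 1 by rw [← det_fin_two, M.det_coe])
  exact h ▸ affineCode_mem h1 h2 h3 h4 h5 h6 h7

/-- The homomorphism that lets `SL₂(7)` act affinely on the projective line. -/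
noncomputable def toAffineGroupEight :
    SpecialLinearGroup (Fin 2) (ZMod 7) →* AffineGroupEight :=
  MonoidHom.mk' (fun M => (exists_code_eq_actCode M).choose) fun M N => by
    have hc := AffineGroup.isCoding (.refl (MulAut ElemAbEight))
    apply hc.injective
    rw [hc.map_mul, (exists_code_eq_actCode _).choose_spec, (exists_code_eq_actCode M).choose_spec,
      (exists_code_eq_actCode N).choose_spec, ← actCode_comp]
    congr 1
    ext1 x
    simp [mul_smul]

theorem code_toAffineGroupEight (M : SpecialLinearGroup (Fin 2) (ZMod 7)) :
    AffineGroup.code (.refl _) (toAffineGroupEight M) =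
      fractionalLinearCode (M 0 0) (M 0 1) (M 1 0) (M 1 1) :=
  (exists_code_eq_actCode M).choose_spec.trans (fractionalLinearCode_eq M).symm

/-- The linear parts of the affine maps given by `SL₂(7)`. -/
noncomputable def toMulAut : SpecialLinearGroup (Fin 2) (ZMod 7) →* MulAut ElemAbEight :=
  SemidirectProduct.rightHom.comp toAffineGroupEight

theorem mem_center_iff_coeff (M : SpecialLinearGroup (Fin 2) (ZMod 7)) :
    M ∈ Subgroup.center (SpecialLinearGroup (Fin 2) (ZMod 7)) ↔
      M 0 1 = 0 ∧ M 1 0 = 0 ∧ M 0 0 = M 1 1 := by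
  have hdet : M 0 0 * M 1 1 - M 0 1 * M 1 0 = 1 := by rw [← det_fin_two, M.det_coe]
  rw [Matrix.SpecialLinearGroup.mem_center_iff, Fintype.card_fin]
  constructor
  · rintro ⟨r, -, hr⟩
    simp [← hr]
  · rintro ⟨h1, h2, h3⟩
    refine ⟨M 0 0, ?_, ?_⟩
    · rw [h1, ← h3] at hdet
      linear_combination hdet
    · ext i j
      fin_cases i <;> fin_cases j <;> simp [h1, h2, h3]

theorem ker_toMulAut :
    toMulAut.ker = Subgroup.center (SpecialLinearGroup (Fin 2) (ZMod 7)) := by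
  ext M
  rw [mem_center_iff_coeff, ← codeLin_fractionalLinearCode _ _ _ _
    (show M 0 0 * M 1 1 - M 0 1 * M 1 0 = 1 by rw [← det_fin_two, M.det_coe]),
    ← code_toAffineGroupEight, AffineGroup.codeLin_code, AffineGroup.lin,
    ← actCode_id vectorEquiv, (actCode_injective _).eq_iff, MonoidHom.mem_ker]
  change (toAffineGroupEight M).right = 1 ↔ ⇑(toAffineGroupEight M).right = id
  rw [DFunLike.ext'_iff]
  rfl

theorem card_specialLinearGroup_seven :
    Nat.card (SpecialLinearGroup (Fin 2) (ZMod 7)) = 336 := by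
  let e : SpecialLinearGroup (Fin 2) (ZMod 7) ≃
      {q : (ZMod 7 × ZMod 7) × ZMod 7 × ZMod 7 // q.1.1 * q.2.2 - q.1.2 * q.2.1 = 1} :=
    { toFun := fun M => ⟨((M 0 0, M 0 1), M 1 0, M 1 1), by rw [← det_fin_two, M.det_coe]⟩
      invFun := fun q => ⟨!![q.1.1.1, q.1.1.2; q.1.2.1, q.1.2.2], by
        rw [det_fin_two]; exact q.2⟩
      left_inv := fun M => by
        ext i j
        fin_cases i <;> fin_cases j <;> rfl
      right_inv := fun q => rfl }
  rw [Nat.card_congr e, Nat.card_eq_fintype_card]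
  decide +kernel

theorem card_center_specialLinearGroup_seven_le :
    Nat.card (Subgroup.center (SpecialLinearGroup (Fin 2) (ZMod 7))) ≤ 2 := by
  let f : Subgroup.center (SpecialLinearGroup (Fin 2) (ZMod 7)) → {a : ZMod 7 // a * a = 1} :=
    fun M => ⟨M.1 0 0, by
      obtain ⟨h1, h2, h3⟩ := (mem_center_iff_coeff _).1 M.2
      have hdet : M.1 0 0 * M.1 1 1 - M.1 0 1 * M.1 1 0 = 1 := by rw [← det_fin_two, M.1.det_coe]
      rw [h1, ← h3] at hdet
      linear_combination hdet⟩
  have hf : Function.Injective f := by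
    intro M N h
    have h0 : M.1 0 0 = N.1 0 0 := congrArg Subtype.val h
    obtain ⟨h1, h2, h3⟩ := (mem_center_iff_coeff _).1 M.2
    obtain ⟨k1, k2, k3⟩ := (mem_center_iff_coeff _).1 N.2
    ext i j
    fin_cases i <;> fin_cases j
    exacts [h0, h1.trans k1.symm, h2.trans k2.symm, h3.symm.trans (h0.trans k3)]
  refine (Nat.card_le_card_of_injective f hf).trans ?_
  rw [Nat.card_eq_fintype_card]
  decide +kernel

/-- By counting: `336 / 2 = 168`. -/
theorem toMulAut_surjective : Function.Surjective toMulAut := by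
  rw [← MonoidHom.range_eq_top]
  have := Nat.finite_of_card_ne_zero (card_mulAut_elemAbEight.trans_ne (by norm_num))
  refine Subgroup.eq_top_of_le_card _ ?_
  rw [card_mulAut_elemAbEight, ← Subgroup.index_ker, ker_toMulAut]
  have h1 := Subgroup.card_mul_index (Subgroup.center (SpecialLinearGroup (Fin 2) (ZMod 7)))
  rw [card_specialLinearGroup_seven] at h1
  have h2 := card_center_specialLinearGroup_seven_le
  nlinarith

/-- The isomorphism of `PSL₂(7)` with the automorphism group of `2³`. -/
noncomputable def pslEquivMulAut : PSLTwoSeven ≃* MulAut ElemAbEight :=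
  (QuotientGroup.quotientMulEquivOfEq ker_toMulAut.symm).trans
    (QuotientGroup.quotientKerEquivOfSurjective toMulAut toMulAut_surjective)

end ProjectiveLine

/-! ### The non-split extension -/

section NonSplitExtension

/-- The code of the automorphism that changes the sign of the points `i` with `⟨a, i⟩ = 1`, where
`⟨a, i⟩` is the standard bilinear form on three-bit numbers. -/
def signChangeCode (a : ℕ) : ℕ :=
  pack fun i => i + 8 * (((a &&& i) + (a &&& i) / 2 + (a &&& i) / 4) % 2)

theorem signChangeCode_mem : ∀ a : Fin 8, signChangeCode a ∈ automorphismCodes := by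
  decide +kernel

theorem signChangeCode_xor : ∀ a b : Fin 8,
    signChangeCode (a ^^^ b : ℕ) = codeComp (signChangeCode a) (signChangeCode b) := by
  decide +kernel

theorem signChangeCode_injective : ∀ a b : Fin 8, signChangeCode a = signChangeCode b → a = b := by
  decide +kernel

theorem codeLin_signChangeCode : ∀ a : Fin 8, codeLin (signChangeCode a) = codeOne := by
  decide +kernel

/-- The automorphisms with trivial linear part are the changes of signs. -/
theorem automorphismCodes_signChange : automorphismCodes.all fun p =>
    codeLin p != codeOne || (List.finRange 8).any fun a => signChangeCode a == p := by
  decide +kernel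

/-- An automorphism that commutes with all changes of signs has trivial linear part. -/
theorem automorphismCodes_centralizer : automorphismCodes.all fun p =>
    codeLin p == codeOne || (List.finRange 8).any fun a =>
      codeComp p (signChangeCode a) != codeComp (signChangeCode a) p := by
  decide +kernel

/-- If the fourth power of an automorphism is trivial, then its square is a change of signs. -/
theorem automorphismCodes_pow_four : automorphismCodes.all fun p =>
    codePow p 4 != codeOne || codeLin (codePow p 2) == codeOne := by
  decide +kernel

/-- There is an automorphism with linear part of order four. -/
theorem automorphismCodes_any_pow_four : automorphismCodes.any fun p =>
    codeLin (codePow p 4) == codeOne && codeLin (codePow p 2) != codeOne := by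
  decide +kernel

namespace octonionUnitAut

/-- The embedding of `2³` by changes of signs. -/
noncomputable def signChange : ElemAbEight →* octonionUnitAut :=
  MonoidHom.mk' (fun x => (exists_code_eq (signChangeCode_mem (vectorEquiv x))).choose)
      fun x y => by
    apply isCoding.injective
    rw [isCoding.map_mul, (exists_code_eq (signChangeCode_mem _)).choose_spec,
      (exists_code_eq (signChangeCode_mem _)).choose_spec,
      (exists_code_eq (signChangeCode_mem _)).choose_spec, vectorEquiv_mul, signChangeCode_xor]

theorem code_signChange (x : ElemAbEight) :
    code (signChange x) = signChangeCode (vectorEquiv x) :=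
  (exists_code_eq (signChangeCode_mem _)).choose_spec

theorem signChange_injective : Function.Injective signChange := by
  intro x y h
  rw [← vectorEquiv.injective.eq_iff]
  apply signChangeCode_injective
  rw [← code_signChange, ← code_signChange, h]

theorem mem_range_signChange_iff (f : octonionUnitAut) :
    f ∈ signChange.range ↔ codeLin (code f) = codeOne := by
  constructor
  · rintro ⟨x, rfl⟩
    rw [code_signChange, codeLin_signChangeCode]
  · intro h
    have := List.all_eq_true.1 automorphismCodes_signChange _ (code_mem f)
    rw [h, bne_self_eq_false, Bool.false_or, List.any_eq_true] at this
    obtain ⟨a, -, ha⟩ := this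
    refine ⟨vectorEquiv.symm a, isCoding.injective ?_⟩
    rw [code_signChange, Equiv.apply_symm_apply, beq_iff_eq.1 ha]

instance normal_range_signChange : signChange.range.Normal where
  conj_mem n hn g := by
    rw [mem_range_signChange_iff] at *
    rw [codeLin_code_mul, codeLin_code_mul, hn, ← codeLin_code_one, ← codeLin_code_mul, mul_one,
      ← codeLin_code_mul, mul_inv_cancel]

/-- The extension of the quotient by the changes of signs. -/
noncomputable def quotientExtension :
    GroupExtension ElemAbEight octonionUnitAut (octonionUnitAut ⧸ signChange.range) where
  inl := signChange
  rightHom := QuotientGroup.mk' _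
  inl_injective := signChange_injective
  range_inl_eq_ker_rightHom := (QuotientGroup.ker_mk' _).symm
  rightHom_surjective := QuotientGroup.mk'_surjective _

/-- The changes of signs form a self-centralizing subgroup. -/
theorem ker_conjAct : quotientExtension.conjAct.ker = signChange.range := by
  ext f
  have h : f ∈ quotientExtension.conjAct.ker ↔ ∀ x, f * signChange x = signChange x * f := by
    rw [MonoidHom.mem_ker, MulEquiv.ext_iff]
    refine forall_congr' fun x => ?_
    rw [← signChange_injective.eq_iff, ← mul_inv_eq_iff_eq_mul]
    exact Eq.congr_left quotientExtension.inl_conjAct_comm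
  rw [h]
  constructor
  · intro hf
    rw [mem_range_signChange_iff]
    have := List.all_eq_true.1 automorphismCodes_centralizer _ (code_mem f)
    rw [Bool.or_eq_true, beq_iff_eq] at this
    refine this.resolve_right fun hany => ?_
    obtain ⟨a, -, ha⟩ := List.any_eq_true.1 hany
    have h1 := congrArg code (hf (vectorEquiv.symm a))
    rw [isCoding.map_mul, isCoding.map_mul, code_signChange, Equiv.apply_symm_apply] at h1
    exact bne_iff_ne.1 ha h1
  · rintro ⟨y, rfl⟩ x
    rw [← _root_.map_mul, ← _root_.map_mul, mul_comm]

/-- By counting: `1344 / 8 = 168`. -/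
theorem conjAct_surjective : Function.Surjective quotientExtension.conjAct := by
  rw [← MonoidHom.range_eq_top]
  have := Nat.finite_of_card_ne_zero (card_mulAut_elemAbEight.trans_ne (by norm_num))
  refine Subgroup.eq_top_of_le_card _ ?_
  rw [card_mulAut_elemAbEight, ← Subgroup.index_ker, ker_conjAct]
  have h1 := Subgroup.card_mul_index signChange.range
  rw [isCoding.card_eq isClassSystem_automorphismCodes.nodup,
    isClassSystem_automorphismCodes.length,
    ← Nat.card_congr (MonoidHom.ofInjective signChange_injective).toEquiv,
    Nat.card_congr vectorEquiv, Nat.card_eq_fintype_card, Fintype.card_fin] at h1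
  omega

/-- The extension of `PSL₂(7)` by `2³` formed by the automorphisms of the octonionic set. -/
noncomputable def extension : GroupExtension ElemAbEight octonionUnitAut PSLTwoSeven where
  inl := signChange
  rightHom := pslEquivMulAut.symm.toMonoidHom.comp quotientExtension.conjAct
  inl_injective := signChange_injective
  range_inl_eq_ker_rightHom := by
    refine ker_conjAct.symm.trans ?_
    ext f
    simp [MonoidHom.mem_ker]
  rightHom_surjective := pslEquivMulAut.symm.surjective.comp conjAct_surjective

theorem extension_conjAct_surjective : Function.Surjective extension.conjAct :=
  conjAct_surjective

/-- In a splitting, an element of order four of `PSL₂(7)` would lift to an automorphism of order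
four whose square is not a change of signs. -/
theorem isEmpty_splitting : IsEmpty extension.Splitting := by
  refine ⟨fun s => ?_⟩
  have hker : ∀ f, extension.rightHom f = 1 ↔ codeLin (code f) = codeOne := fun f => by
    rw [← mem_range_signChange_iff, ← MonoidHom.mem_ker, ← extension.range_inl_eq_ker_rightHom]
    rfl
  obtain ⟨p, hp, hpe⟩ := List.any_eq_true.1 automorphismCodes_any_pow_four
  obtain ⟨f, rfl⟩ := exists_code_eq hp
  rw [Bool.and_eq_true, beq_iff_eq, bne_iff_ne, ← isCoding.map_pow, ← isCoding.map_pow, ← hker,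
    Ne, ← hker, map_pow, map_pow] at hpe
  obtain ⟨h4, h2⟩ := hpe
  set t := extension.rightHom f
  have := List.all_eq_true.1 automorphismCodes_pow_four _ (code_mem (s t))
  rw [← isCoding.map_pow, ← isCoding.map_pow, ← map_pow, h4, _root_.map_one, isCoding.map_one,
    bne_self_eq_false, Bool.false_or, beq_iff_eq, ← hker, map_pow, s.rightHom_splitting] at this
  exact h2 this

end octonionUnitAut

end NonSplitExtension

/-! ### The comparison of the two groups -/

/-- Only the non-split group contains elements of order eight. -/
theorem isEmpty_mulEquiv_of_hasCharacterTable {G H : Type} [Group G] [Group H]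
    {T T' : Matrix (Fin 11) (Fin 11) ℂ} {size size' : Fin 11 → ℕ}
    (hG : HasCharacterTable G T size nonSplitClassOrders)
    (hH : HasCharacterTable H T' size' splitClassOrders) : IsEmpty (G ≃* H) := by
  refine ⟨fun e => ?_⟩
  obtain ⟨C, -, -, hC, -⟩ := hG
  obtain ⟨D, -, -, hD, -⟩ := hH
  obtain ⟨g, hg⟩ := (C 9).exists_rep
  have h1 : orderOf g = 8 := hC 9 g (ConjClasses.mem_carrier_iff_mk_eq.2 hg)
  have h2 := hD (D.symm (ConjClasses.mk (e g))) (e g)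
    (by rw [Equiv.apply_symm_apply]; exact ConjClasses.mem_carrier_mk)
  rw [MulEquiv.orderOf_eq, h1] at h2
  have h3 : ∀ j, 8 ≠ splitClassOrders j := by decide
  exact h3 _ h2

theorem mainTheorem3 :
    -- the group of the octonionic set is a non-split extension of `2^3` by `PSL_2(7)`,
    -- inducing by conjugation the full automorphism group of `2^3`
    (∃ S : GroupExtension ElemAbEight octonionUnitAut PSLTwoSeven,
      Function.Surjective S.conjAct ∧ IsEmpty S.Splitting) ∧
    -- `PSL_2(7)` is the automorphism group of `2^3`, so that the split extension exists
    Nonempty (PSLTwoSeven ≃* MulAut ElemAbEight) ∧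
    -- the table for the non-split group
    HasCharacterTable octonionUnitAut commonCharacterTable commonClassSizes nonSplitClassOrders ∧
    RealExceptDegreeThree octonionUnitAut ∧
    -- the same table for the split group, and the two groups are not isomorphic
    ∀ φ : PSLTwoSeven ≃* MulAut ElemAbEight,
      HasCharacterTable (SplitExtension φ) commonCharacterTable commonClassSizes
        splitClassOrders ∧
      RealExceptDegreeThree (SplitExtension φ) ∧
      IsEmpty (octonionUnitAut ≃* SplitExtension φ) :=
  ⟨⟨octonionUnitAut.extension, octonionUnitAut.extension_conjAct_surjective,
      octonionUnitAut.isEmpty_splitting⟩, ⟨pslEquivMulAut⟩, octonionUnitAut.table.1,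
    octonionUnitAut.table.2, fun φ => ⟨(AffineGroup.table φ).1, (AffineGroup.table φ).2,
      isEmpty_mulEquiv_of_hasCharacterTable octonionUnitAut.table.1 (AffineGroup.table φ).1⟩⟩
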